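/- Let $R$ be a commutative Noetherian ring and let $A$ be an $R$-algebra that is finitely generated and projective as an $R$-module. Write $A\text{-mod}$ for the category of finitely generated left $A$-modules, $A\text{-proj}$ for its full subcategory of projective modules, $R\text{-proj}$ for the category of finitely generated projective $R$-modules, and $D=\operatorname{Hom}_R(-,R)$. For a set $\theta$ of $A$-modules, $\mathcal F(\theta)$ denotes the class of $M\in A\text{-mod}$ having a finite filtration by submodules whose successive quotients are isomorphic to modules in $\theta$. Let $\Lambda$ be a finite poset and let $(A,\{\Delta(\lambda)\}_{\lambda\in\Lambda})$ be a split quasi-hereditary $R$-algebra, that is: (i) $\Delta(\lambda)\in A\text{-mod}\cap R\text{-proj}$; (ii) $\operatorname{Hom}_A(\Delta(\lambda),\Delta(\mu))\ne 0$ implies $\lambda\le\mu$; (iii) $\operatorname{End}_A(\Delta(\lambda))\cong R$; (iv) for every $\lambda$ there are $P(\lambda)\in A\text{-proj}$ and an exact sequence $0\to C(\lambda)\to P(\lambda)\to\Delta(\lambda)\to 0$ with $C(\lambda)\in\mathcal F(\{\Delta(\mu)\otimes_R U:\mu>\lambda,\ U\in R\text{-proj}\})$; (v) the class of direct summands of finite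 direct sums of copies of $\bigoplus_\lambda P(\lambda)$ is $A\text{-proj}$. Let $\{\nabla(\lambda)\}_{\lambda\in\Lambda}$ be its costandard modules, that is, modules in $A\text{-mod}\cap R\text{-proj}$ (unique up to isomorphism) such that $(A^{op},\{D\nabla(\lambda)\}_{\lambda\in\Lambda})$ is split quasi-hereditary and $\operatorname{Ext}^i_A(\Delta(\lambda),\nabla(\mu))$ is $R$ if $i=0$ and $\lambda=\mu$, and $0$ otherwise. Put $\tilde\Delta=\{\Delta(\lambda)\otimes_R U:\lambda\in\Lambda,\ U\in R\text{-proj}\}$ and $\tilde\nabla=\{\nabla(\lambda)\otimes_R U:\lambda\in\Lambda,\ U\in R\text{-proj}\}$. Theorem. Let $M\in A\text{-mod}\cap R\text{-proj}$. 1. If $\operatorname{Ext}^1_A(M,\nabla(\lambda))=0$ for all $\lambda\in\Lambda$, then $M\in\mathcal F(\tilde\Delta)$. 2. If $\operatorname{Ext}^1_A(\Delta(\lambda),M)=0$ for all $\lambda\in\Lambda$, then $M\in\mathcal F(\tilde\nabla)$. Consequently $\mathcal F(\tilde\Delta)$ is a resolving subcategory of $A\text{-mod}\cap R\text{-proj}$: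 it is contained in $A\text{-mod}\cap R\text{-proj}$, it contains all finitely generated projective $A$-modules, and it is closed under extensions, under direct summands and under kernels of epimorphisms. -/

import Mathlib

open scoped TensorProduct DirectSum

universe u w

namespace SplitQH

/-- The `R`-dual `D M = Hom_R(M, R)`. It is a type of its own so that it can carry the action of
the opposite algebra that comes from the action of `A` on `M`. -/
def RDual (R M : Type u) [CommRing R] [AddCommGroup M] [Module R M] : Type u := M →ₗ[R] R

section Dual

variable (R M : Type u) [CommRing R] [AddCommGroup M] [Module R M]

instance : AddCommGroup (RDual R M) := inferInstanceAs (AddCommGroup (M →ₗ[R] R))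

instance : Module R (RDual R M) := inferInstanceAs (Module R (M →ₗ[R] R))

/-- The left `Aᵐᵒᵖ`-module structure on `D M`: `(a • f) m = f (a m)`. -/
instance (A : Type u) [Ring A] [Algebra R A] [Module A M] [IsScalarTower R A M] :
    Module Aᵐᵒᵖ (RDual R M) where
  smul a f := LinearMap.comp (show M →ₗ[R] R from f) (Algebra.lsmul R R M a.unop)
  one_smul f := LinearMap.ext fun m => by
    change (show M →ₗ[R] R from f) ((1 : A) • m) = _
    rw [one_smul]
  mul_smul a b f := LinearMap.ext fun m => by
    change (show M →ₗ[R] R from f) ((b.unop * a.unop) • m) =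
      (show M →ₗ[R] R from f) (b.unop • a.unop • m)
    rw [mul_smul]
  smul_zero _ := rfl
  smul_add _ _ _ := rfl
  add_smul a b f := LinearMap.ext fun m => by
    change (show M →ₗ[R] R from f) ((a.unop + b.unop) • m) =
      (show M →ₗ[R] R from f) (a.unop • m) + (show M →ₗ[R] R from f) (b.unop • m)
    rw [add_smul, map_add]
  zero_smul f := LinearMap.ext fun m => by
    change (show M →ₗ[R] R from f) ((0 : A) • m) = 0
    rw [zero_smul, map_zero]

instance (A : Type u) [Ring A] [Algebra R A] [Module A M] [IsScalarTower R A M] :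
    IsScalarTower R Aᵐᵒᵖ (RDual R M) where
  smul_assoc r a f := LinearMap.ext fun m => by
    change (show M →ₗ[R] R from f) ((r • a.unop) • m) =
      r • (show M →ₗ[R] R from f) (a.unop • m)
    rw [smul_assoc, map_smul]

end Dual

/-- `X` lies in the additive closure `add_A M`: it is (isomorphic to) a direct summand of a finite
direct sum of copies of `M`. -/
def InAdd (A : Type u) [Ring A] (M : Type*) [AddCommGroup M] [Module A M]
    (X : Type*) [AddCommGroup X] [Module A X] : Prop :=
  ∃ (n : ℕ) (i : X →ₗ[A] (Fin n → M)) (p : (Fin n → M) →ₗ[A] X), p ∘ₗ i = LinearMap.id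

/-- `M` has a finite filtration `0 = F 0 ≤ F 1 ≤ ⋯ ≤ F n = M` by `A`-submodules such that every
quotient `F (i + 1) / F i` is isomorphic to `Θ l ⊗[R] U` for some index `l ∈ S` and some finitely
generated projective `R`-module `U`. -/
def HasFiltration (R A : Type u) [CommRing R] [Ring A] [Algebra R A] {Λ : Type w}
    (Θ : Λ → Type u) [∀ l, AddCommGroup (Θ l)] [∀ l, Module R (Θ l)] [∀ l, Module A (Θ l)]
    [∀ l, IsScalarTower R A (Θ l)] (S : Set Λ)
    (M : Type u) [AddCommGroup M] [Module A M] : Prop :=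
  ∃ (n : ℕ) (F : ℕ → Submodule A M), F 0 = ⊥ ∧ F n = ⊤ ∧
    ∀ i < n, F i ≤ F (i + 1) ∧
      ∃ l ∈ S, ∃ (U : Type u) (_ : AddCommGroup U) (_ : Module R U),
        Module.Finite R U ∧ Module.Projective R U ∧
          Nonempty ((↥(F (i + 1)) ⧸ (F i).submoduleOf (F (i + 1))) ≃ₗ[A] (Θ l ⊗[R] U))

/-- `(A, Δ)` is a split quasi-hereditary `R`-algebra with standard modules `Δ l`. -/
structure IsSplitQuasiHereditary (R A : Type u) [CommRing R] [Ring A] [Algebra R A]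
    {Λ : Type w} [PartialOrder Λ]
    (Δ : Λ → Type u) [∀ l, AddCommGroup (Δ l)] [∀ l, Module R (Δ l)] [∀ l, Module A (Δ l)]
    [∀ l, IsScalarTower R A (Δ l)] : Prop where
  alg_finite : Module.Finite R A
  alg_projective : Module.Projective R A
  finite : ∀ l, Module.Finite A (Δ l)
  projective : ∀ l, Module.Projective R (Δ l)
  le_of_hom_ne_zero : ∀ l m, (∃ f : Δ l →ₗ[A] Δ m, f ≠ 0) → l ≤ m
  end_equiv : ∀ l, Nonempty (Module.End A (Δ l) ≃ₐ[R] R)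
  /-- The projective modules `P l` with `0 → ker π → P l → Δ l → 0`, where `ker π` is filtered by
  modules `Δ m ⊗ U` with `m > l`, and `add (⨁ P l)` is the category of finitely generated
  projective `A`-modules. -/
  exists_projectives : ∃ P : Λ → ModuleCat.{u} A,
    (∀ l, Module.Finite A (P l) ∧ Module.Projective A (P l) ∧
      ∃ π : P l →ₗ[A] Δ l, Function.Surjective π ∧
        HasFiltration R A Δ (Set.Ioi l) (LinearMap.ker π)) ∧
    ∀ X : ModuleCat.{u} A,
      InAdd A (⨁ l, P l) X ↔ (Module.Finite A X ∧ Module.Projective A X)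

/-- `Ext_A^n(M, N) = 0`. -/
def ExtVanishes (A : Type u) [Ring A] (M N : Type u) [AddCommGroup M] [Module A M]
    [AddCommGroup N] [Module A N] (n : ℕ) : Prop :=
  Subsingleton (CategoryTheory.Abelian.Ext.{u} (ModuleCat.of A M) (ModuleCat.of A N) n)

/-- The modules `nab l` are costandard modules of the split quasi-hereditary algebra `(A, Δ)`:
`(A^op, D nab)` is split quasi-hereditary for the same order, and
`Ext_A^i(Δ l, nab m)` is `R` if `i = 0` and `l = m`, and `0` otherwise. -/
structure IsCostandard (R A : Type u) [CommRing R] [Ring A] [Algebra R A]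
    {Λ : Type w} [PartialOrder Λ]
    (Δ : Λ → Type u) [∀ l, AddCommGroup (Δ l)] [∀ l, Module R (Δ l)] [∀ l, Module A (Δ l)]
    [∀ l, IsScalarTower R A (Δ l)]
    (nab : Λ → Type u) [∀ l, AddCommGroup (nab l)] [∀ l, Module R (nab l)]
    [∀ l, Module A (nab l)] [∀ l, IsScalarTower R A (nab l)] : Prop where
  finite : ∀ l, Module.Finite A (nab l)
  projective : ∀ l, Module.Projective R (nab l)
  dual : IsSplitQuasiHereditary R Aᵐᵒᵖ (fun l => RDual R (nab l))
  hom_self : ∀ l, Nonempty ((Δ l →ₗ[A] nab l) ≃ₗ[R] R)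
  hom_ne : ∀ l m, l ≠ m → Subsingleton (Δ l →ₗ[A] nab m)
  ext_pos : ∀ l m, ∀ i : ℕ, 0 < i → ExtVanishes A (Δ l) (nab m) i

/-- The full subcategory of `A`-modules with property `F` is a resolving subcategory of
`A-mod ∩ R-proj`: it lies in it, contains the finitely generated projective `A`-modules, and is
closed under extensions, direct summands and kernels of epimorphisms. -/
structure IsResolving (R A : Type u) [CommRing R] [Ring A] [Algebra R A]
    (F : ModuleCat.{u} A → Prop) : Prop where
  finite : ∀ M, F M → Module.Finite A M
  projective : ∀ M, F M → Module.Projective R (RestrictScalars R A M)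
  of_projective : ∀ M : ModuleCat.{u} A, Module.Finite A M → Module.Projective A M → F M
  extension : ∀ (X Y Z : ModuleCat.{u} A) (f : X →ₗ[A] Y) (g : Y →ₗ[A] Z),
    Function.Injective f → Function.Exact f g → Function.Surjective g → F X → F Z → F Y
  summand : ∀ (X M : ModuleCat.{u} A) (i : X →ₗ[A] M) (p : M →ₗ[A] X),
    p ∘ₗ i = LinearMap.id → F M → F X
  kernel : ∀ (M N : ModuleCat.{u} A) (f : M →ₗ[A] N),
    Function.Surjective f → F M → F N → F (ModuleCat.of A (LinearMap.ker f))

end SplitQH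

/-!
Since `End (Δ l) = R`, a module of the form `Δ l ⊗ U` with `U` finitely generated projective over
`R` is the same thing as a direct summand of some `Δ l ^ n` (`InAdd.exists_tensorProduct`,
`inAdd_tensorProduct`). So standard filtrations are handled as iterated extensions `Filt` by such
summands (`hasFiltration_iff_filt`), and everything takes place among `A`-modules: neither quotient
algebras of `A` nor the duality with `Aᵐᵒᵖ`-modules are needed.

The projective presentation `P l → Δ l`, whose kernel is filtered by larger standard modules, makes
`Δ l` projective relative to the modules receiving no map from larger standard modules
(`IsSplitQuasiHereditary.extVanishes`). Hence, if `l` is maximal in `S`, a module filtered by the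
`Δ m`, `m ∈ S`, has a submodule `T` in the additive closure of `Δ l` with quotient filtered by the
`Δ m`, `m ∈ S \ {l}` (`IsSplitQuasiHereditary.exists_peel`). As there are no maps from `Δ l` to the
quotient, `T` is functorial. Removing maximal weights one at a time, closure of the filtered modules
under direct summands and under kernels of epimorphisms reduces to the additive closure of `Δ l`,
where it is plain (`filt_retract`, `filt_ker`). This makes the category resolving.

Let now `Ext¹(Δ l, Y) = 0` for all `l`. Filtering `A` itself by standard modules gives a chain of
two-sided ideals (`exists_ideal`). For `l` maximal among the weights that remain, and `I` the
corresponding ideal, `Y → Hom(I, Y)` is onto because `A ⧸ I` has a standard filtration, and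
`Hom(I, Y) ≅ Hom(I, Δ l) ⊗ Hom(Δ l, Y)`. Applied to `Y = nab l` this shows `nab l ≅ Hom(I, Δ l)`, so
`Y` has a quotient `nab l ⊗ Hom(Δ l, Y)`; the kernel satisfies the same hypotheses with fewer
weights (`IsCostandard.hasFiltration`).

Finally, a finitely generated `M` sits in an exact sequence `0 → Y → X → M → 0` with `X` filtered by
standard modules and `Ext¹(Δ l, Y) = 0` for all `l` (`exists_approximation`, by universal extensions). If
`Ext¹(M, nab l) = 0` for all `l`, then `Ext¹(M, Y) = 0` by the costandard filtration of `Y`, so `M`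
is a direct summand of `X` (`IsCostandard.hasFiltration_standard`).
-/

namespace SplitQH

/-! ### Vanishing of `Ext¹` in terms of lifting and extending maps -/

section Ext

open CategoryTheory CategoryTheory.Abelian

variable {A : Type u} [Ring A]
  {X Y Z M N : Type u} [AddCommGroup X] [AddCommGroup Y] [AddCommGroup Z] [AddCommGroup M]
  [AddCommGroup N] [Module A X] [Module A Y] [Module A Z] [Module A M] [Module A N]
  {f : X →ₗ[A] Y} {g : Y →ₗ[A] Z}

/-- A concrete short exact sequence of modules, as a short exact complex in `ModuleCat`. -/
theorem shortExact_of_exact (hf : Function.Injective f) (hfg : Function.Exact f g)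
    (hg : Function.Surjective g) :
    (ShortComplex.mk (ModuleCat.ofHom f) (ModuleCat.ofHom g)
      (by ext x; exact hfg.apply_apply_eq_zero x)).ShortExact :=
  ModuleCat.shortComplex_shortExact _ hfg hf hg

theorem ExtVanishes.exists_lift (hf : Function.Injective f) (hfg : Function.Exact f g)
    (hg : Function.Surjective g) (h : ExtVanishes A M X 1) (φ : M →ₗ[A] Z) :
    ∃ ψ : M →ₗ[A] Y, g ∘ₗ ψ = φ := by
  have := h
  unfold ExtVanishes at this
  obtain ⟨x, hx⟩ := Ext.covariant_sequence_exact₃ (ModuleCat.of A M)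
    (shortExact_of_exact hf hfg hg) (Ext.mk₀ (ModuleCat.ofHom φ)) (zero_add 1)
    (Subsingleton.elim _ _)
  obtain ⟨ψ, rfl⟩ := (Ext.mk₀_bijective _ _).2 x
  refine ⟨ψ.hom, ?_⟩
  rw [Ext.mk₀_comp_mk₀] at hx
  exact congrArg ModuleCat.Hom.hom ((Ext.mk₀_bijective _ _).1 hx)

theorem ExtVanishes.exists_extend (hf : Function.Injective f) (hfg : Function.Exact f g)
    (hg : Function.Surjective g) (h : ExtVanishes A Z N 1) (φ : X →ₗ[A] N) :
    ∃ ψ : Y →ₗ[A] N, ψ ∘ₗ f = φ := by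
  have := h
  unfold ExtVanishes at this
  obtain ⟨x, hx⟩ := Ext.contravariant_sequence_exact₁ (shortExact_of_exact hf hfg hg)
    (ModuleCat.of A N) (Ext.mk₀ (ModuleCat.ofHom φ)) (add_zero 1) (Subsingleton.elim _ _)
  obtain ⟨ψ, rfl⟩ := (Ext.mk₀_bijective _ _).2 x
  refine ⟨ψ.hom, ?_⟩
  rw [Ext.mk₀_comp_mk₀] at hx
  exact congrArg ModuleCat.Hom.hom ((Ext.mk₀_bijective _ _).1 hx)

theorem ExtVanishes.of_exists_extend [Module.Projective A Y] (hf : Function.Injective f)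
    (hfg : Function.Exact f g) (hg : Function.Surjective g)
    (h : ∀ φ : X →ₗ[A] N, ∃ ψ : Y →ₗ[A] N, ψ ∘ₗ f = φ) : ExtVanishes A Z N 1 := by
  have hS := shortExact_of_exact hf hfg hg
  have : Projective (ModuleCat.of A Y) := (IsProjective.iff_projective Y).1 inferInstance
  refine subsingleton_of_forall_eq 0 fun x => ?_
  obtain ⟨y, hy⟩ := Ext.contravariant_sequence_exact₃ hS (ModuleCat.of A N) x
    (Ext.eq_zero_of_projective _) (add_zero 1)
  obtain ⟨φ, rfl⟩ := (Ext.mk₀_bijective _ _).2 y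
  obtain ⟨ψ, hψ⟩ := h φ.hom
  have : φ = ModuleCat.ofHom f ≫ ModuleCat.ofHom ψ := by ext1; exact hψ.symm
  rw [← hy, this, ← Ext.mk₀_comp_mk₀]
  exact hS.extClass_comp_assoc _

/-- If every map `M → Z` lifts to `Y`, then `Ext¹(M, X) → Ext¹(M, Y)` is injective. -/
theorem ExtVanishes.of_exists_lift (hf : Function.Injective f) (hfg : Function.Exact f g)
    (hg : Function.Surjective g) (h : ExtVanishes A M Y 1)
    (hlift : ∀ φ : M →ₗ[A] Z, ∃ ψ : M →ₗ[A] Y, g ∘ₗ ψ = φ) : ExtVanishes A M X 1 := by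
  have hS := shortExact_of_exact hf hfg hg
  have := h
  unfold ExtVanishes at this
  refine subsingleton_of_forall_eq 0 fun x => ?_
  obtain ⟨y, hy⟩ := Ext.covariant_sequence_exact₁ (ModuleCat.of A M) hS x
    (Subsingleton.elim _ _) (zero_add 1)
  obtain ⟨φ, rfl⟩ := (Ext.mk₀_bijective _ _).2 y
  obtain ⟨ψ, hψ⟩ := hlift φ.hom
  have : φ = ModuleCat.ofHom ψ ≫ ModuleCat.ofHom g := by ext1; exact hψ.symm
  rw [← hy, this, ← Ext.mk₀_comp_mk₀, Ext.comp_assoc_of_second_deg_zero]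
  exact (congrArg (fun z => (Ext.mk₀ (ModuleCat.ofHom ψ)).comp z (zero_add 1))
    hS.comp_extClass).trans (Ext.comp_zero _ _ _ _ _)

theorem ExtVanishes.of_exact_left (hf : Function.Injective f) (hfg : Function.Exact f g)
    (hg : Function.Surjective g) (hX : ExtVanishes A X N 1) (hZ : ExtVanishes A Z N 1) :
    ExtVanishes A Y N 1 := by
  have hS := shortExact_of_exact hf hfg hg
  unfold ExtVanishes at *
  refine subsingleton_of_forall_eq 0 fun x => ?_
  obtain ⟨y, rfl⟩ := Ext.contravariant_sequence_exact₂ hS (ModuleCat.of A N) x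
    (Subsingleton.elim _ _)
  have : y = 0 := Subsingleton.elim (α := Ext (ModuleCat.of A Z) _ _) _ _
  rw [this, Ext.comp_zero]

theorem ExtVanishes.of_exact_right (hf : Function.Injective f) (hfg : Function.Exact f g)
    (hg : Function.Surjective g) (hX : ExtVanishes A M X 1) (hZ : ExtVanishes A M Z 1) :
    ExtVanishes A M Y 1 := by
  have hS := shortExact_of_exact hf hfg hg
  unfold ExtVanishes at *
  refine subsingleton_of_forall_eq 0 fun x => ?_
  obtain ⟨y, rfl⟩ := Ext.covariant_sequence_exact₂ (ModuleCat.of A M) hS x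
    (Subsingleton.elim _ _)
  have : y = 0 := Subsingleton.elim (α := Ext _ (ModuleCat.of A X) _) _ _
  rw [this, Ext.zero_comp]

theorem ExtVanishes.of_retract_left {n : ℕ} {i : X →ₗ[A] Y} {p : Y →ₗ[A] X}
    (hip : p ∘ₗ i = LinearMap.id) (h : ExtVanishes A Y N n) : ExtVanishes A X N n := by
  unfold ExtVanishes at *
  refine subsingleton_of_forall_eq 0 fun x => ?_
  have hid : ModuleCat.ofHom i ≫ ModuleCat.ofHom p = 𝟙 _ := by ext1; exact hip
  have : x = (Ext.mk₀ (ModuleCat.ofHom i)).comp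
      ((Ext.mk₀ (ModuleCat.ofHom p)).comp x (zero_add n)) (zero_add n) := by
    rw [Ext.mk₀_comp_mk₀_assoc, hid, Ext.mk₀_id_comp]
  rw [this, Subsingleton.elim ((Ext.mk₀ (ModuleCat.ofHom p)).comp x (zero_add n)) 0,
    Ext.comp_zero]

theorem ExtVanishes.of_retract_right {n : ℕ} {i : X →ₗ[A] Y} {p : Y →ₗ[A] X}
    (hip : p ∘ₗ i = LinearMap.id) (h : ExtVanishes A M Y n) : ExtVanishes A M X n := by
  unfold ExtVanishes at *
  refine subsingleton_of_forall_eq 0 fun x => ?_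
  have hid : ModuleCat.ofHom i ≫ ModuleCat.ofHom p = 𝟙 _ := by ext1; exact hip
  have : x = (x.comp (Ext.mk₀ (ModuleCat.ofHom i)) (add_zero n)).comp
      (Ext.mk₀ (ModuleCat.ofHom p)) (add_zero n) := by
    rw [Ext.comp_assoc_of_third_deg_zero, Ext.mk₀_comp_mk₀, hid, Ext.comp_mk₀_id]
  rw [this, Subsingleton.elim (x.comp (Ext.mk₀ (ModuleCat.ofHom i)) (add_zero n)) 0,
    Ext.zero_comp]

theorem ExtVanishes.of_subsingleton_left [Subsingleton M] (n : ℕ) : ExtVanishes A M N n := by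
  refine subsingleton_of_forall_eq 0 fun x => ?_
  rw [← Ext.mk₀_id_comp x, show 𝟙 (ModuleCat.of A M) = 0 from
    (ModuleCat.isZero_of_subsingleton (ModuleCat.of A M)).eq_of_src _ _, Ext.mk₀_zero,
    Ext.zero_comp]

theorem ExtVanishes.of_subsingleton_right [Subsingleton N] (n : ℕ) : ExtVanishes A M N n := by
  refine subsingleton_of_forall_eq 0 fun x => ?_
  rw [← Ext.comp_mk₀_id x, show 𝟙 (ModuleCat.of A N) = 0 from
    (ModuleCat.isZero_of_subsingleton (ModuleCat.of A N)).eq_of_src _ _, Ext.mk₀_zero,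
    Ext.comp_zero]

end Ext

/-! ### Filtrations with factors in additive closures -/

section Filtrations

variable {A : Type u} [Ring A]

/-- A class of `A`-modules that contains the zero modules and is closed under extensions and
direct summands. -/
structure ExtClosed (C : ModuleCat.{u} A → Prop) : Prop where
  zero : ∀ X : ModuleCat.{u} A, Subsingleton X → C X
  ext : ∀ ⦃X Y Z : ModuleCat.{u} A⦄ (f : X →ₗ[A] Y) (g : Y →ₗ[A] Z), Function.Injective f →
    Function.Exact f g → Function.Surjective g → C X → C Z → C Y
  retract : ∀ ⦃X Y : ModuleCat.{u} A⦄ (i : X →ₗ[A] Y) (p : Y →ₗ[A] X),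
    p ∘ₗ i = LinearMap.id → C Y → C X

namespace ExtClosed

variable {C : ModuleCat.{u} A → Prop} (hC : ExtClosed C)
include hC

theorem of_equiv {X Y : Type u} [AddCommGroup X] [AddCommGroup Y] [Module A X] [Module A Y]
    (e : X ≃ₗ[A] Y) (h : C (ModuleCat.of A Y)) : C (ModuleCat.of A X) :=
  hC.retract (X := ModuleCat.of A X) (Y := ModuleCat.of A Y) e.toLinearMap e.symm.toLinearMap
    (by ext; simp) h

theorem prod {X Y : Type u} [AddCommGroup X] [AddCommGroup Y] [Module A X] [Module A Y]
    (hX : C (ModuleCat.of A X)) (hY : C (ModuleCat.of A Y)) : C (ModuleCat.of A (X × Y)) :=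
  hC.ext (X := ModuleCat.of A X) (Y := ModuleCat.of A (X × Y)) (Z := ModuleCat.of A Y)
    (LinearMap.inl A X Y) (LinearMap.snd A X Y) LinearMap.inl_injective .inl_snd
    LinearMap.snd_surjective hX hY

theorem pi_fin : ∀ {n : ℕ} {X : Fin n → Type u} [∀ k, AddCommGroup (X k)] [∀ k, Module A (X k)],
    (∀ k, C (ModuleCat.of A (X k))) → C (ModuleCat.of A (∀ k, X k))
  | 0, _, _, _, _ => hC.zero _ (inferInstanceAs (Subsingleton (∀ _ : Fin 0, _)))
  | _ + 1, X, _, _, h =>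
    hC.of_equiv (Fin.consLinearEquiv A X).symm (hC.prod (h 0) (pi_fin fun k => h k.succ))

theorem inAdd {X Z : Type u} [AddCommGroup X] [AddCommGroup Z] [Module A X] [Module A Z]
    (hX : C (ModuleCat.of A X)) (h : InAdd A X Z) : C (ModuleCat.of A Z) := by
  obtain ⟨n, i, p, hip⟩ := h
  exact hC.retract (X := ModuleCat.of A Z) (Y := ModuleCat.of A (Fin n → X)) i p hip
    (hC.pi_fin fun _ => hX)

/-- The index type of the sum may live in another universe: being finite, it can be replaced by
some `Fin m`. -/
theorem inAdd_directSum {Λ : Type w} [Finite Λ] {P : Λ → ModuleCat.{u} A} (hP : ∀ l, C (P l))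
    {Z : Type u} [AddCommGroup Z] [Module A Z] (h : InAdd A (⨁ l, P l) Z) :
    C (ModuleCat.of A Z) := by
  obtain ⟨n, i, p, hip⟩ := h
  have := Fintype.ofFinite Λ
  obtain ⟨m, ⟨e⟩⟩ := Finite.exists_equiv_fin Λ
  let E : (⨁ l, P l) ≃ₗ[A] (∀ j : Fin m, P (e.symm j)) :=
    (DirectSum.linearEquivFunOnFintype A Λ fun l => P l).trans
      (LinearEquiv.piCongrLeft A (fun l => P l) e.symm).symm
  let E' : (Fin n → ⨁ l, P l) ≃ₗ[A] (Fin n → ∀ j : Fin m, P (e.symm j)) :=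
    LinearEquiv.piCongrRight fun _ => E
  refine hC.retract (X := ModuleCat.of A Z)
    (Y := ModuleCat.of A (Fin n → ∀ j : Fin m, P (e.symm j)))
    (E'.toLinearMap ∘ₗ i) (p ∘ₗ E'.symm.toLinearMap) ?_
    (hC.pi_fin fun _ => hC.pi_fin fun _ => hP _)
  ext z
  simpa using congr($hip z)

end ExtClosed

section InAdd

variable {X Y Z : Type*} [AddCommGroup X] [AddCommGroup Y] [AddCommGroup Z] [Module A X]
  [Module A Y] [Module A Z]

theorem InAdd.of_retract {i : Y →ₗ[A] Z} {p : Z →ₗ[A] Y} (hip : p ∘ₗ i = LinearMap.id)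
    (h : InAdd A X Z) : InAdd A X Y := by
  obtain ⟨n, j, q, hjq⟩ := h
  refine ⟨n, j ∘ₗ i, p ∘ₗ q, ?_⟩
  rw [LinearMap.comp_assoc, ← LinearMap.comp_assoc i, hjq, LinearMap.id_comp, hip]

theorem InAdd.of_equiv (e : Y ≃ₗ[A] Z) (h : InAdd A X Z) : InAdd A X Y :=
  h.of_retract (i := e.toLinearMap) (p := e.symm.toLinearMap) (by ext; simp)

theorem InAdd.prod (hY : InAdd A X Y) (hZ : InAdd A X Z) : InAdd A X (Y × Z) := by
  obtain ⟨n, i, p, hip⟩ := hY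
  obtain ⟨m, j, q, hjq⟩ := hZ
  let E : ((Fin n → X) × (Fin m → X)) ≃ₗ[A] (Fin (n + m) → X) :=
    (LinearEquiv.sumArrowLequivProdArrow (Fin n) (Fin m) A X).symm.trans
      (LinearEquiv.funCongrLeft A X finSumFinEquiv.symm)
  refine ⟨n + m, E.toLinearMap ∘ₗ i.prodMap j, p.prodMap q ∘ₗ E.symm.toLinearMap, ?_⟩
  ext z
  · simpa using congr($hip z)
  · simp
  · simp
  · simpa using congr($hjq z)

theorem InAdd.exists_coordinates (h : InAdd A X Y) :
    ∃ (n : ℕ) (i : Fin n → (Y →ₗ[A] X)) (p : Fin n → (X →ₗ[A] Y)),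
      ∀ y, ∑ k, p k (i k y) = y := by
  obtain ⟨n, i, p, hip⟩ := h
  refine ⟨n, fun k => LinearMap.proj k ∘ₗ i, fun k => p ∘ₗ LinearMap.single A (fun _ => X) k,
    fun y => ?_⟩
  conv_rhs => rw [← LinearMap.id_apply (R := A) y, ← hip, LinearMap.comp_apply,
    ← Finset.univ_sum_single (i y), map_sum]
  rfl

theorem InAdd.pi_self (n : ℕ) : InAdd A X (Fin n → X) :=
  ⟨n, LinearMap.id, LinearMap.id, rfl⟩

theorem InAdd.self : InAdd A X X :=
  (InAdd.pi_self 1).of_equiv (LinearEquiv.funUnique (Fin 1) A X).symm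

end InAdd

variable {Λ : Type w} (Θ : Λ → Type u) [∀ l, AddCommGroup (Θ l)] [∀ l, Module A (Θ l)]

/-- `X` is obtained from a zero module by finitely many extensions by direct summands of finite
sums of copies of the modules `Θ l`, `l ∈ S`. When `End (Θ l) = R`, these summands are the modules
`Θ l ⊗ U` with `U` finitely generated projective over `R`, see `hasFiltration_iff_filt`. -/
inductive Filt (S : Set Λ) : ModuleCat.{u} A → Prop
  | zero (X : ModuleCat.{u} A) (hX : Subsingleton X) : Filt S X
  | step {X Y Z : ModuleCat.{u} A} (f : X →ₗ[A] Y) (g : Y →ₗ[A] Z) (hf : Function.Injective f)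
      (hfg : Function.Exact f g) (hg : Function.Surjective g) {l : Λ} (hl : l ∈ S)
      (hX : Filt S X) (hZ : InAdd A (Θ l) Z) : Filt S Y

variable {Θ}

theorem ExtClosed.filt {C : ModuleCat.{u} A → Prop} (hC : ExtClosed C) {S : Set Λ}
    (hS : ∀ l ∈ S, C (ModuleCat.of A (Θ l))) {M : ModuleCat.{u} A} (hM : Filt Θ S M) : C M := by
  induction hM with
  | zero X hX => exact hC.zero X hX
  | step f g hf hfg hg hl _ hZ ih => exact hC.ext f g hf hfg hg ih (hC.inAdd (hS _ hl) hZ)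

theorem Filt.mono {S T : Set Λ} (hST : S ⊆ T) {M : ModuleCat.{u} A} (hM : Filt Θ S M) :
    Filt Θ T M := by
  induction hM with
  | zero X hX => exact .zero X hX
  | step f g hf hfg hg hl _ hZ ih => exact .step f g hf hfg hg (hST hl) ih hZ

theorem Filt.subsingleton {M : ModuleCat.{u} A} (hM : Filt Θ ∅ M) : Subsingleton M := by
  cases hM with
  | zero X hX => exact hX
  | step f g hf hfg hg hl _ hZ => exact hl.elim

theorem Filt.of_equiv {S : Set Λ} {X Y : ModuleCat.{u} A} (e : X ≃ₗ[A] Y) (hX : Filt Θ S X) :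
    Filt Θ S Y := by
  cases hX with
  | zero _ hX => exact .zero _ e.symm.injective.subsingleton
  | step f g hf hfg hg hl hX hZ =>
    exact .step (e.toLinearMap ∘ₗ f) (g ∘ₗ e.symm.toLinearMap) (e.injective.comp hf)
      (fun y => by simpa [LinearEquiv.eq_symm_apply] using hfg (e.symm y))
      (hg.comp e.symm.surjective) hl hX hZ

theorem Filt.ext {S : Set Λ} {X Y Z : ModuleCat.{u} A} (f : X →ₗ[A] Y) (g : Y →ₗ[A] Z)
    (hf : Function.Injective f) (hfg : Function.Exact f g) (hg : Function.Surjective g)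
    (hX : Filt Θ S X) (hZ : Filt Θ S Z) : Filt Θ S Y := by
  induction hZ generalizing X Y with
  | zero Z hZ =>
    refine Filt.of_equiv (LinearEquiv.ofBijective f ⟨hf, fun y => ?_⟩) hX
    exact (hfg y).1 (Subsingleton.elim _ _)
  | @step Z' Z Z'' f' g' hf' hfg' hg' l hl _ hZ'' ih =>
    -- The preimage of `Z'` in `Y` is an extension of `Z'` by `X`.
    let K := LinearMap.ker (g' ∘ₗ g)
    have hK : ∀ y, y ∈ K ↔ ∃ z, f' z = g y := fun y => hfg' (g y)
    let e := LinearEquiv.ofInjective f' hf'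
    let p : K →ₗ[A] Z' := e.symm.toLinearMap ∘ₗ (g ∘ₗ K.subtype).codRestrict _
      (fun y => (hK y).1 y.2)
    have hp : ∀ y : K, f' (p y) = g y := fun y => congrArg Subtype.val (e.apply_symm_apply _)
    refine .step (X := ModuleCat.of A K) K.subtype (g' ∘ₗ g) K.injective_subtype
      (LinearMap.exact_subtype_ker_map _) (hg'.comp hg) hl
      (ih (X := X) (Y := ModuleCat.of A K)
        (f.codRestrict K fun x => by simp [K, hfg.apply_apply_eq_zero x]) p ?_ ?_ ?_ hX) hZ''
    · exact fun x y h => hf (congrArg Subtype.val h)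
    · intro y
      rw [← hf'.eq_iff, hp, map_zero, hfg y]
      exact ⟨fun ⟨x, hx⟩ => ⟨x, Subtype.ext hx⟩, fun ⟨x, hx⟩ => ⟨x, congrArg Subtype.val hx⟩⟩
    · intro z
      obtain ⟨y, hy⟩ := hg (f' z)
      exact ⟨⟨y, (hK y).2 ⟨z, hy.symm⟩⟩, hf' ((hp _).trans hy)⟩

theorem Filt.of_inAdd {S : Set Λ} {l : Λ} (hl : l ∈ S) {Z : ModuleCat.{u} A}
    (hZ : InAdd A (Θ l) Z) : Filt Θ S Z :=
  .step (X := ModuleCat.of A PUnit.{u + 1}) (0 : PUnit.{u + 1} →ₗ[A] Z) LinearMap.id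
    (Function.injective_of_subsingleton _)
    (fun y => ⟨fun h => ⟨0, by simpa using h.symm⟩, fun ⟨x, hx⟩ => by simpa using hx.symm⟩)
    Function.surjective_id hl (.zero _ inferInstance) hZ

end Filtrations

/-! ### Comparison with filtrations by submodules -/

section Tensor

variable (R : Type u) {A : Type u} [CommRing R] [Ring A] [Algebra R A]
  {D : Type u} [AddCommGroup D] [Module R D] [Module A D] [IsScalarTower R A D]

theorem inAdd_tensorProduct (U : Type u) [AddCommGroup U] [Module R U] [Module.Finite R U]
    [Module.Projective R U] : InAdd A D (D ⊗[R] U) := by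
  obtain ⟨n, q, hq⟩ := Module.Finite.exists_fin' R U
  obtain ⟨s, hs⟩ := Module.projective_lifting_property q LinearMap.id hq
  let i : D ⊗[R] U →ₗ[A] (Fin n → D) := LinearMap.pi fun k =>
    (TensorProduct.AlgebraTensorModule.rid R A D).toLinearMap ∘ₗ
      TensorProduct.AlgebraTensorModule.lTensor A D (LinearMap.proj k ∘ₗ s)
  let p : (Fin n → D) →ₗ[A] D ⊗[R] U := ∑ k,
    (TensorProduct.AlgebraTensorModule.lTensor A D
      (LinearMap.toSpanSingleton R U (q (Pi.single k 1))) ∘ₗ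
        (TensorProduct.AlgebraTensorModule.rid R A D).symm.toLinearMap) ∘ₗ LinearMap.proj k
  refine ⟨n, i, p, ?_⟩
  refine LinearMap.ext fun t => ?_
  induction t with
  | zero => simp
  | add x y hx hy => rw [map_add, hx, hy, map_add]
  | tmul x u =>
    have hu : u = ∑ k, s u k • q (Pi.single k 1) := by
      conv_lhs => rw [← LinearMap.id_apply (R := R) u, ← hs, LinearMap.comp_apply,
        ← Finset.univ_sum_single (s u), map_sum]
      refine Finset.sum_congr rfl fun k _ => ?_
      rw [← map_smul, ← Pi.single_smul, smul_eq_mul, mul_one]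
    conv_rhs => rw [LinearMap.id_apply, hu, TensorProduct.tmul_sum]
    simp [i, p, TensorProduct.smul_tmul]

/-- If `End D = R`, the direct summands of finite sums of copies of `D` are the `D ⊗ U` with `U`
finitely generated projective, namely `U = Hom(D, E)`. -/
theorem InAdd.exists_tensorProduct (hD : Function.Bijective (algebraMap R (Module.End A D)))
    {E : Type u} [AddCommGroup E] [Module A E] (hE : InAdd A D E) :
    ∃ (U : Type u) (_ : AddCommGroup U) (_ : Module R U), Module.Finite R U ∧
      Module.Projective R U ∧ Nonempty (E ≃ₗ[A] D ⊗[R] U) := by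
  let := Module.restrictScalars R A E
  have := IsScalarTower.restrictScalars R A E
  obtain ⟨n, i', p', hsum⟩ := hE.exists_coordinates
  -- `Hom(D, E)` is a direct summand of `End(D) ^ n = R ^ n`.
  let C : (D →ₗ[A] D) ≃ₗ[R] R :=
    (LinearEquiv.ofBijective (Algebra.linearMap R (Module.End A D)) hD).symm
  have hC : ∀ (φ : D →ₗ[A] D) (x : D), φ x = C φ • x := fun φ x => by
    have : Algebra.linearMap R (Module.End A D) (C φ) = φ :=
      (LinearEquiv.ofBijective (Algebra.linearMap R (Module.End A D)) hD).apply_symm_apply φ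
    conv_lhs => rw [← this]
    rfl
  let I : (D →ₗ[A] E) →ₗ[R] (Fin n → R) :=
    { toFun := fun f k => C (i' k ∘ₗ f)
      map_add' := fun f g => by ext k; simp [LinearMap.comp_add]
      map_smul' := fun r f => by
        ext k
        have : i' k ∘ₗ (r • f) = r • (i' k ∘ₗ f) := by
          ext x; exact ((i' k).restrictScalars R).map_smul r (f x)
        simp [this] }
  let J : (Fin n → R) →ₗ[R] (D →ₗ[A] E) := Fintype.linearCombination R p'
  have hJI : J ∘ₗ I = LinearMap.id := by
    refine LinearMap.ext fun f => LinearMap.ext fun x => ?_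
    simp only [J, I, LinearMap.comp_apply, Fintype.linearCombination_apply, LinearMap.coe_mk,
      AddHom.coe_mk, LinearMap.sum_apply, LinearMap.smul_apply, LinearMap.id_apply]
    conv_rhs => rw [← hsum (f x)]
    refine Finset.sum_congr rfl fun k _ => ?_
    rw [← LinearMap.comp_apply (i' k) f, hC (i' k ∘ₗ f) x]
    exact (((p' k).restrictScalars R).map_smul _ x).symm
  refine ⟨D →ₗ[A] E, inferInstance, inferInstance, ?_, .of_split I J hJI, ⟨?_⟩⟩
  · exact Module.Finite.of_surjective J fun f => ⟨I f, congr($hJI f)⟩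
  let ev : D ⊗[R] (D →ₗ[A] E) →ₗ[A] E := TensorProduct.AlgebraTensorModule.lift
    { toFun := fun x =>
        { toFun := fun f => f x
          map_add' := fun _ _ => rfl
          map_smul' := fun _ _ => rfl }
      map_add' := fun x y => by ext f; exact f.map_add x y
      map_smul' := fun a x => by ext f; exact f.map_smul a x }
  have hev : ∀ x f, ev (x ⊗ₜ f) = f x := fun _ _ => rfl
  refine (LinearEquiv.ofBijective ev ⟨?_, fun e => ⟨∑ k, i' k e ⊗ₜ p' k, ?_⟩⟩).symm
  · refine Function.LeftInverse.injective (g := fun e => ∑ k, i' k e ⊗ₜ[R] p' k) fun t => ?_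
    induction t with
    | zero => simp
    | add x y hx hy =>
      rw [map_add]
      conv_rhs => rw [← hx, ← hy, ← Finset.sum_add_distrib]
      exact Finset.sum_congr rfl fun k _ => by rw [map_add, TensorProduct.add_tmul]
    | tmul x f =>
      rw [hev]
      have hf : f = ∑ k, C (i' k ∘ₗ f) • p' k := congr($hJI f).symm
      conv_rhs => rw [hf, TensorProduct.tmul_sum]
      refine Finset.sum_congr rfl fun k _ => ?_
      rw [TensorProduct.tmul_smul, TensorProduct.smul_tmul', ← hC]
      rfl
  · rw [map_sum]
    exact hsum e

end Tensor

section Filtration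

variable (R : Type u) {A : Type u} [CommRing R] [Ring A] [Algebra R A] {Λ : Type w}
  {Θ : Λ → Type u} [∀ l, AddCommGroup (Θ l)] [∀ l, Module R (Θ l)] [∀ l, Module A (Θ l)]
  [∀ l, IsScalarTower R A (Θ l)] {S : Set Λ}

theorem HasFiltration.filt {M : Type u} [AddCommGroup M] [Module A M]
    (h : HasFiltration R A Θ S M) : Filt Θ S (ModuleCat.of A M) := by
  obtain ⟨n, F, h0, hn, hF⟩ := h
  have key : ∀ i ≤ n, Filt Θ S (ModuleCat.of A (F i)) := by
    intro i
    induction i with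
    | zero => exact fun _ => .zero _ (by rw [h0]; infer_instance)
    | succ i ih =>
      intro hi
      obtain ⟨hle, l, hl, U, _, _, _, _, ⟨e⟩⟩ := hF i hi
      have hex : Function.Exact (Submodule.inclusion hle)
          (e.toLinearMap ∘ₗ Submodule.mkQ ((F i).submoduleOf (F (i + 1)))) := fun y => by
        change e (Submodule.Quotient.mk y) = 0 ↔ _
        rw [e.map_eq_zero_iff, Submodule.Quotient.mk_eq_zero]
        exact ⟨fun h => ⟨⟨y, h⟩, rfl⟩, fun ⟨x, hx⟩ => hx ▸ x.2⟩
      exact .step (X := ModuleCat.of A (F i)) (Y := ModuleCat.of A (F (i + 1)))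
        (Z := ModuleCat.of A (Θ l ⊗[R] U)) (Submodule.inclusion hle)
        (e.toLinearMap ∘ₗ Submodule.mkQ _) (Submodule.inclusion_injective hle)
        hex
        (e.surjective.comp (Submodule.mkQ_surjective _)) hl (ih (by omega))
        (inAdd_tensorProduct R U)
  have := key n le_rfl
  rw [hn] at this
  exact this.of_equiv (X := ModuleCat.of A (⊤ : Submodule A M)) (Y := ModuleCat.of A M)
    Submodule.topEquiv

theorem HasFiltration.of_subsingleton (M : Type u) [AddCommGroup M] [Module A M]
    [Subsingleton M] : HasFiltration R A Θ S M :=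
  ⟨0, fun _ => ⊥, rfl, Subsingleton.elim _ _, fun _ h => absurd h (Nat.not_lt_zero _)⟩

theorem HasFiltration.step {X Y Z : Type u} [AddCommGroup X] [AddCommGroup Y] [AddCommGroup Z]
    [Module A X] [Module A Y] [Module A Z] {f : X →ₗ[A] Y} {g : Y →ₗ[A] Z}
    (hf : Function.Injective f) (hfg : Function.Exact f g) (hg : Function.Surjective g)
    {l : Λ} (hl : l ∈ S) (U : Type u) [AddCommGroup U] [Module R U] [Module.Finite R U]
    [Module.Projective R U] (e : Z ≃ₗ[A] Θ l ⊗[R] U) (hX : HasFiltration R A Θ S X) :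
    HasFiltration R A Θ S Y := by
  obtain ⟨n, F, h0, hn, hF⟩ := hX
  obtain ⟨G, hG, hG'⟩ : ∃ G : ℕ → Submodule A Y, (∀ i ≤ n, G i = (F i).map f) ∧
      G (n + 1) = ⊤ :=
    ⟨fun i => if i ≤ n then (F i).map f else ⊤, fun i hi => if_pos hi, if_neg (by omega)⟩
  refine ⟨n + 1, G, by rw [hG 0 (Nat.zero_le n), h0, Submodule.map_bot], hG', fun i hi => ?_⟩
  rcases Nat.lt_succ_iff_lt_or_eq.1 hi with hi | rfl
  · obtain ⟨hle, k, hk, V, _, _, hV, hV', ⟨d⟩⟩ := hF i hi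
    rw [hG i hi.le, hG (i + 1) hi]
    refine ⟨Submodule.map_mono hle, k, hk, V, _, _, hV, hV', ⟨(?_ : _ ≃ₗ[A] _).trans d⟩⟩
    refine (Submodule.Quotient.equiv _ _ (Submodule.equivMapOfInjective f hf (F (i + 1))) ?_).symm
    ext ⟨y, hy⟩
    obtain ⟨x, hx, rfl⟩ := hy
    simp only [Submodule.mem_map, Submodule.submoduleOf, Submodule.mem_comap,
      Submodule.subtype_apply]
    constructor
    · rintro ⟨z, hz, h⟩
      exact ⟨z, hz, congrArg Subtype.val h⟩
    · rintro ⟨z, hz, h⟩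
      exact ⟨⟨z, hle hz⟩, hz, Subtype.ext h⟩
  · rw [hG', hG i le_rfl, hn, Submodule.map_top]
    refine ⟨le_top, l, hl, U, _, _, ‹_›, ‹_›, ⟨(?_ : _ ≃ₗ[A] Z).trans e⟩⟩
    refine (Submodule.quotEquivOfEq _ (LinearMap.ker (g ∘ₗ (⊤ : Submodule A Y).subtype)) ?_).trans
      (LinearMap.quotKerEquivOfSurjective _ fun z => ?_)
    · ext y
      exact (hfg y).symm
    · obtain ⟨y, hy⟩ := hg z
      exact ⟨⟨y, trivial⟩, hy⟩

theorem hasFiltration_iff_filt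
    (hΘ : ∀ l, Function.Bijective (algebraMap R (Module.End A (Θ l)))) {M : ModuleCat.{u} A} :
    HasFiltration R A Θ S M ↔ Filt Θ S M := by
  refine ⟨fun h => h.filt, fun h => ?_⟩
  induction h with
  | zero X hX => exact .of_subsingleton R X
  | step f g hf hfg hg hl _ hZ ih =>
    obtain ⟨U, _, _, _, _, ⟨e⟩⟩ := hZ.exists_tensorProduct R (hΘ _)
    exact ih.step R hf hfg hg hl U e

end Filtration

/-! ### Orthogonality of standard modules -/

section Orthogonality

variable {A : Type u} [Ring A]

theorem hom_subsingleton_of_injective {X Y Y' : Type*} [AddCommGroup X] [AddCommGroup Y]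
    [AddCommGroup Y'] [Module A X] [Module A Y] [Module A Y'] (f : Y' →ₗ[A] Y)
    (hf : Function.Injective f) (h : Subsingleton (X →ₗ[A] Y)) : Subsingleton (X →ₗ[A] Y') :=
  ⟨fun a b => LinearMap.cancel_left hf |>.1 (Subsingleton.elim (f ∘ₗ a) (f ∘ₗ b))⟩

theorem hom_subsingleton_of_surjective {X X' Y : Type*} [AddCommGroup X] [AddCommGroup Y]
    [AddCommGroup X'] [Module A X] [Module A Y] [Module A X'] (f : X' →ₗ[A] X)
    (hf : Function.Surjective f) (h : Subsingleton (X' →ₗ[A] Y)) : Subsingleton (X →ₗ[A] Y) :=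
  ⟨fun a b => LinearMap.cancel_right hf |>.1 (Subsingleton.elim (a ∘ₗ f) (b ∘ₗ f))⟩

/-- A map into the middle of a short exact sequence whose composite with the second map vanishes
factors through the first map. -/
theorem exists_comp_eq_of_exact {W X Y Z : Type*} [AddCommGroup W] [AddCommGroup X]
    [AddCommGroup Y] [AddCommGroup Z] [Module A W] [Module A X] [Module A Y] [Module A Z]
    {f : X →ₗ[A] Y} {g : Y →ₗ[A] Z} (hf : Function.Injective f) (hfg : Function.Exact f g)
    (φ : W →ₗ[A] Y) (h : g ∘ₗ φ = 0) : ∃ ψ : W →ₗ[A] X, f ∘ₗ ψ = φ := by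
  refine ⟨(LinearEquiv.ofInjective f hf).symm.toLinearMap ∘ₗ φ.codRestrict (LinearMap.range f)
    fun w => (hfg (φ w)).1 congr($h w), LinearMap.ext fun w => ?_⟩
  exact congrArg Subtype.val ((LinearEquiv.ofInjective f hf).apply_symm_apply _)

/-- A map out of the middle of a short exact sequence whose composite with the first map vanishes
factors through the second map. -/
theorem exists_comp_eq_of_exact' {W X Y Z : Type*} [AddCommGroup W] [AddCommGroup X]
    [AddCommGroup Y] [AddCommGroup Z] [Module A W] [Module A X] [Module A Y] [Module A Z]
    {f : X →ₗ[A] Y} {g : Y →ₗ[A] Z} (hfg : Function.Exact f g) (hg : Function.Surjective g)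
    (φ : Y →ₗ[A] W) (h : φ ∘ₗ f = 0) : ∃ ψ : Z →ₗ[A] W, ψ ∘ₗ g = φ := by
  have hker : LinearMap.ker g ≤ LinearMap.ker φ := fun y hy => by
    obtain ⟨x, rfl⟩ := (hfg y).1 hy
    exact congr($h x)
  refine ⟨(LinearMap.ker g).liftQ φ hker ∘ₗ (g.quotKerEquivOfSurjective hg).symm.toLinearMap,
    LinearMap.ext fun y => ?_⟩
  have : (g.quotKerEquivOfSurjective hg).symm (g y) = Submodule.Quotient.mk y := by
    rw [LinearEquiv.symm_apply_eq]
    rfl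
  simp [this]

theorem extClosed_hom_left (N : Type*) [AddCommGroup N] [Module A N] :
    ExtClosed (A := A) fun X => Subsingleton (X →ₗ[A] N) where
  zero X hX := ⟨fun a b => LinearMap.ext fun x => by
    rw [Subsingleton.elim x 0, map_zero, map_zero]⟩
  ext X Y Z f g hf hfg hg hX hZ := subsingleton_of_forall_eq 0 fun a => by
    obtain ⟨b, rfl⟩ := exists_comp_eq_of_exact' hfg hg a (Subsingleton.elim _ _)
    rw [Subsingleton.elim b 0, LinearMap.zero_comp]
  retract X Y i p hip h := hom_subsingleton_of_surjective p
    (fun x => ⟨i x, congr($hip x)⟩) h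

theorem extClosed_hom_right (M : Type*) [AddCommGroup M] [Module A M] :
    ExtClosed (A := A) fun X => Subsingleton (M →ₗ[A] X) where
  zero X hX := ⟨fun a b => LinearMap.ext fun x => Subsingleton.elim _ _⟩
  ext X Y Z f g hf hfg hg hX hZ := subsingleton_of_forall_eq 0 fun a => by
    obtain ⟨b, rfl⟩ := exists_comp_eq_of_exact hf hfg a (Subsingleton.elim _ _)
    rw [Subsingleton.elim b 0, LinearMap.comp_zero]
  retract X Y i p hip h := hom_subsingleton_of_injective i
    (Function.LeftInverse.injective (g := p) fun x => congr($hip x)) h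

theorem extClosed_ext_left (N : Type u) [AddCommGroup N] [Module A N] :
    ExtClosed (A := A) fun X => ExtVanishes A X N 1 where
  zero _ _ := .of_subsingleton_left 1
  ext _ _ _ _ _ hf hfg hg hX hZ := .of_exact_left hf hfg hg hX hZ
  retract _ _ _ _ hip h := h.of_retract_left hip

theorem extClosed_ext_right (M : Type u) [AddCommGroup M] [Module A M] :
    ExtClosed (A := A) fun X => ExtVanishes A M X 1 where
  zero _ _ := .of_subsingleton_right 1
  ext _ _ _ _ _ hf hfg hg hX hZ := .of_exact_right hf hfg hg hX hZ
  retract _ _ _ _ hip h := h.of_retract_right hip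

variable {R : Type u} [CommRing R] [Algebra R A] {Λ : Type w} [PartialOrder Λ]
  {Δ : Λ → Type u} [∀ l, AddCommGroup (Δ l)] [∀ l, Module R (Δ l)] [∀ l, Module A (Δ l)]
  [∀ l, IsScalarTower R A (Δ l)]

namespace IsSplitQuasiHereditary

theorem exists_presentation (hA : IsSplitQuasiHereditary R A Δ) (l : Λ) :
    ∃ (P : ModuleCat.{u} A) (π : P →ₗ[A] Δ l), Module.Finite A P ∧ Module.Projective A P ∧
      Function.Surjective π ∧ Filt Δ (Set.Ioi l) (ModuleCat.of A (LinearMap.ker π)) := by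
  obtain ⟨P, hP, -⟩ := hA.exists_projectives
  obtain ⟨h1, h2, π, hπ, h3⟩ := hP l
  exact ⟨P l, π, h1, h2, hπ, h3.filt⟩

theorem algebraMap_bijective (hA : IsSplitQuasiHereditary R A Δ) (l : Λ) :
    Function.Bijective (algebraMap R (Module.End A (Δ l))) := by
  obtain ⟨e⟩ := hA.end_equiv l
  have : ⇑(algebraMap R (Module.End A (Δ l))) = e.symm := by
    ext1 r
    exact (e.symm.commutes r).symm
  rw [this]
  exact e.symm.bijective

theorem hom_subsingleton (hA : IsSplitQuasiHereditary R A Δ) {l m : Λ} (h : ¬ l ≤ m) :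
    Subsingleton (Δ l →ₗ[A] Δ m) :=
  subsingleton_of_forall_eq 0 fun f => by
    by_contra hf
    exact h (hA.le_of_hom_ne_zero l m ⟨f, hf⟩)

theorem hom_subsingleton_of_filt (hA : IsSplitQuasiHereditary R A Δ) {S : Set Λ} {l : Λ}
    (hl : ∀ m ∈ S, ¬ l ≤ m) {M : ModuleCat.{u} A} (hM : Filt Δ S M) :
    Subsingleton (Δ l →ₗ[A] M) :=
  (extClosed_hom_right (Δ l)).filt (fun m hm => hA.hom_subsingleton (hl m hm)) hM

theorem hom_subsingleton_of_inAdd (hA : IsSplitQuasiHereditary R A Δ) {S : Set Λ} {l : Λ}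
    (hl : ∀ m ∈ S, ¬ l ≤ m) {T : Type u} [AddCommGroup T] [Module A T] (hT : InAdd A (Δ l) T)
    {M : ModuleCat.{u} A} (hM : Filt Δ S M) : Subsingleton (T →ₗ[A] M) :=
  (extClosed_hom_left M).inAdd (hA.hom_subsingleton_of_filt hl hM) hT

/-- Relative projectivity of `Δ l`: the kernel of `P l → Δ l` is filtered by larger standard
modules. -/
theorem extVanishes (hA : IsSplitQuasiHereditary R A Δ) {l : Λ} {K : Type u} [AddCommGroup K]
    [Module A K] (hK : ∀ m, l < m → Subsingleton (Δ m →ₗ[A] K)) : ExtVanishes A (Δ l) K 1 := by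
  obtain ⟨P, π, -, hP, hπ, hker⟩ := hA.exists_presentation l
  have := (extClosed_hom_left K).filt hK hker
  exact .of_exists_extend (LinearMap.ker π).injective_subtype (LinearMap.exact_subtype_ker_map π)
    hπ fun φ => ⟨0, Subsingleton.elim (α := LinearMap.ker π →ₗ[A] K) _ _⟩

theorem extVanishes_of_filt (hA : IsSplitQuasiHereditary R A Δ) {S : Set Λ} {l : Λ}
    (hl : ∀ m ∈ S, ¬ l < m) {M : ModuleCat.{u} A} (hM : Filt Δ S M) :
    ExtVanishes A (Δ l) M 1 :=
  hA.extVanishes fun _ hk => hA.hom_subsingleton_of_filt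
    (fun m hm hkm => hl m hm (hk.trans_le hkm)) hM

end IsSplitQuasiHereditary

end Orthogonality

/-! ### Splitting off a maximal weight -/

section Peeling

variable {A : Type u} [Ring A] {Λ : Type w} {Δ : Λ → Type u} [∀ l, AddCommGroup (Δ l)]
  [∀ l, Module A (Δ l)]

theorem Filt.of_submodule {S : Set Λ} {M : Type u} [AddCommGroup M] [Module A M]
    (T : Submodule A M) (hT : Filt Δ S (ModuleCat.of A T))
    (hM : Filt Δ S (ModuleCat.of A (M ⧸ T))) : Filt Δ S (ModuleCat.of A M) :=
  Filt.ext (X := ModuleCat.of A T) (Y := ModuleCat.of A M) (Z := ModuleCat.of A (M ⧸ T))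
    T.subtype T.mkQ T.injective_subtype (LinearMap.exact_subtype_mkQ T) T.mkQ_surjective hT hM

theorem le_comap_of_hom_subsingleton {M M' : Type*} [AddCommGroup M] [AddCommGroup M']
    [Module A M] [Module A M'] (φ : M →ₗ[A] M') {T : Submodule A M} {T' : Submodule A M'}
    (h : Subsingleton (T →ₗ[A] M' ⧸ T')) : T ≤ T'.comap φ := fun t ht => by
  have := congr($(Subsingleton.elim (T'.mkQ ∘ₗ φ ∘ₗ T.subtype) 0) ⟨t, ht⟩)
  exact (Submodule.Quotient.mk_eq_zero T').1 this

variable [PartialOrder Λ]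

theorem not_le_of_mem_diff {S : Set Λ} {l : Λ} (hl : ∀ m ∈ S, ¬ l < m) :
    ∀ m ∈ S \ {l}, ¬ l ≤ m :=
  fun m hm h => hl m hm.1 (lt_of_le_of_ne h fun h' => hm.2 h'.symm)

theorem isLowerSet_diff_singleton {S : Set Λ} (hS : IsLowerSet S) {l : Λ}
    (hl : ∀ m ∈ S, ¬ l < m) : IsLowerSet (S \ {l}) := fun _ _ hba ha =>
  ⟨hS hba ha.1, fun hb => hl _ ha.1 (lt_of_le_of_ne (hb ▸ hba) fun h => ha.2 h.symm)⟩

/-- Induction on subsets of a finite poset by removing maximal elements. -/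
theorem maximal_induction [Finite Λ] {C : Set Λ → Prop} (h0 : C ∅)
    (h : ∀ (S : Set Λ) (l : Λ), l ∈ S → (∀ m ∈ S, ¬ l < m) → C (S \ {l}) → C S) (S : Set Λ) :
    C S := by
  induction hn : S.ncard using Nat.strong_induction_on generalizing S with
  | _ n ih =>
    rcases S.eq_empty_or_nonempty with rfl | hS
    · exact h0
    obtain ⟨l, hl⟩ := S.toFinite.exists_maximal hS
    exact h S l hl.1 (fun m hm hlm => hl.not_gt hm hlm)
      (ih _ (hn ▸ Set.ncard_sdiff_singleton_lt_of_mem hl.1) _ rfl)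

variable {R : Type u} [CommRing R] [Algebra R A] [∀ l, Module R (Δ l)]
  [∀ l, IsScalarTower R A (Δ l)]

namespace IsSplitQuasiHereditary

/-- A module filtered by the `Δ m`, `m ∈ S`, has a submodule `T` absorbing all the factors of
type `Δ l`, if `l` is maximal in `S`. -/
theorem exists_peel (hA : IsSplitQuasiHereditary R A Δ) {S : Set Λ} {l : Λ}
    (hl : ∀ m ∈ S, ¬ l < m) {M : ModuleCat.{u} A} (hM : Filt Δ S M) :
    ∃ T : Submodule A M, InAdd A (Δ l) T ∧ Filt Δ (S \ {l}) (ModuleCat.of A (M ⧸ T)) := by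
  induction hM with
  | zero X hX =>
    refine ⟨⊥, ⟨0, 0, 0, Subsingleton.elim _ _⟩, .zero _ ?_⟩
    exact (Submodule.mkQ_surjective (⊥ : Submodule A X)).subsingleton
  | @step X Y Z f g hf hfg hg m hm hX hZ ih =>
    obtain ⟨T, hT, hXT⟩ := ih
    by_cases hml : m = l
    · -- The new factor splits off, since `Ext¹(Δ l, X) = 0`.
      subst hml
      obtain ⟨s, hs⟩ := ((extClosed_ext_left X).inAdd (hA.extVanishes_of_filt hl hX)
        hZ).exists_lift hf hfg hg LinearMap.id
      obtain ⟨e, -, -⟩ := hfg.splitSurjectiveEquiv hf ⟨s, hs⟩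
      let q : Y →ₗ[A] X ⧸ T := T.mkQ ∘ₗ LinearMap.fst A X Z ∘ₗ e.toLinearMap
      have hmem : ∀ y, y ∈ LinearMap.ker q ↔ (e y).1 ∈ T := fun y =>
        Submodule.Quotient.mk_eq_zero T
      have hq : Function.Surjective q :=
        T.mkQ_surjective.comp ((LinearMap.fst_surjective (R := A)).comp e.surjective)
      let i : LinearMap.ker q →ₗ[A] T × Z :=
        ((LinearMap.fst A X Z ∘ₗ e.toLinearMap ∘ₗ (LinearMap.ker q).subtype).codRestrict T
          fun y => (hmem y).1 y.2).prod
            (LinearMap.snd A X Z ∘ₗ e.toLinearMap ∘ₗ (LinearMap.ker q).subtype)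
      let p : T × Z →ₗ[A] LinearMap.ker q :=
        (e.symm.toLinearMap ∘ₗ T.subtype.prodMap LinearMap.id).codRestrict _
          fun z => (hmem _).2 (by simp)
      refine ⟨LinearMap.ker q, (hT.prod hZ).of_retract (i := i) (p := p) ?_, ?_⟩
      · exact LinearMap.ext fun y => Subtype.ext (e.symm_apply_apply y)
      · exact hXT.of_equiv (X := ModuleCat.of A (X ⧸ T))
          (Y := ModuleCat.of A (Y ⧸ LinearMap.ker q)) (q.quotKerEquivOfSurjective hq).symm
    · refine ⟨T.map f, hT.of_equiv (Submodule.equivMapOfInjective f hf T).symm, ?_⟩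
      refine .step (X := ModuleCat.of A (X ⧸ T)) (Y := ModuleCat.of A (Y ⧸ T.map f))
        (T.mapQ (T.map f) f (Submodule.le_comap_map f T))
        ((T.map f).liftQ g ?_) ?_ ?_ ?_ (l := m) ⟨hm, hml⟩ hXT hZ
      · rintro _ ⟨x, -, rfl⟩
        exact hfg.apply_apply_eq_zero x
      · refine LinearMap.ker_eq_bot.1 (LinearMap.ker_eq_bot'.2 fun x => ?_)
        obtain ⟨x, rfl⟩ := T.mkQ_surjective x
        intro hx
        obtain ⟨x', hx', h⟩ := (Submodule.Quotient.mk_eq_zero _).1 hx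
        exact (Submodule.Quotient.mk_eq_zero _).2 (hf h ▸ hx')
      · intro y
        obtain ⟨y, rfl⟩ := (T.map f).mkQ_surjective y
        constructor
        · intro hy
          obtain ⟨x, rfl⟩ := (hfg y).1 hy
          exact ⟨T.mkQ x, rfl⟩
        · rintro ⟨x, hx⟩
          obtain ⟨x, rfl⟩ := T.mkQ_surjective x
          rw [← hx]
          exact hfg.apply_apply_eq_zero x
      · intro z
        obtain ⟨y, rfl⟩ := hg z
        exact ⟨(T.map f).mkQ y, rfl⟩

variable [Finite Λ]

theorem filt_retract (hA : IsSplitQuasiHereditary R A Δ) (S : Set Λ) :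
    ∀ ⦃X M : ModuleCat.{u} A⦄ (i : X →ₗ[A] M) (p : M →ₗ[A] X), p ∘ₗ i = LinearMap.id →
      Filt Δ S M → Filt Δ S X := by
  induction S using maximal_induction with
  | h0 =>
    intro X M i p hip hM
    have := hM.subsingleton
    exact .zero _ (Function.LeftInverse.injective (g := p) fun x => congr($hip x)).subsingleton
  | h S l hlS hl ih =>
    intro X M i p hip hM
    obtain ⟨T, hT, hMT⟩ := hA.exists_peel hl hM
    have hip' : ∀ x, p (i x) = x := fun x => congr($hip x)
    have hp : T ≤ (T.comap i).comap p := le_comap_of_hom_subsingleton (i ∘ₗ p)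
      (hA.hom_subsingleton_of_inAdd (not_le_of_mem_diff hl) hT hMT)
    refine Filt.of_submodule (T.comap i) (.of_inAdd (l := l) hlS ?_)
      (.mono (S := S \ {l}) Set.sdiff_subset ?_)
    · refine hT.of_retract (i := i.restrict (p := T.comap i) (q := T) fun x hx => hx)
        (p := p.restrict hp) ?_
      ext x
      exact hip' x
    · refine ih (X := ModuleCat.of A (X ⧸ T.comap i)) (M := ModuleCat.of A (M ⧸ T))
        ((T.comap i).mapQ T i le_rfl) (T.mapQ (T.comap i) p hp) ?_ hMT
      ext x
      exact congrArg Submodule.Quotient.mk (hip' x)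

theorem extClosed_filt (hA : IsSplitQuasiHereditary R A Δ) (S : Set Λ) :
    ExtClosed (A := A) (Filt Δ S) where
  zero := .zero
  ext _ _ _ := .ext
  retract _ _ i p hip hM := hA.filt_retract S i p hip hM

theorem filt_ker (hA : IsSplitQuasiHereditary R A Δ) (S : Set Λ) :
    ∀ ⦃M N : ModuleCat.{u} A⦄ (f : M →ₗ[A] N), Function.Surjective f → Filt Δ S M →
      Filt Δ S N → Filt Δ S (ModuleCat.of A (LinearMap.ker f)) := by
  induction S using maximal_induction with
  | h0 =>
    intro M N f hf hM hN
    have := hM.subsingleton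
    exact .zero _ (inferInstanceAs (Subsingleton (LinearMap.ker f)))
  | h S l hlS hl ih =>
    intro M N f hf hM hN
    obtain ⟨T, hT, hMT⟩ := hA.exists_peel hl hM
    obtain ⟨T', hT', hNT⟩ := hA.exists_peel hl hN
    have hle : T ≤ T'.comap f := le_comap_of_hom_subsingleton f
      (hA.hom_subsingleton_of_inAdd (not_le_of_mem_diff hl) hT hNT)
    -- The inclusion `T' → N` lifts to `s : T' → M`, whose image lies in `T`.
    have hK : ExtVanishes A (Δ l) (LinearMap.ker f) 1 := hA.extVanishes fun k hk =>
      hom_subsingleton_of_injective _ (LinearMap.ker f).injective_subtype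
        (hA.hom_subsingleton_of_filt (fun m hm hkm => hl m hm (hk.trans_le hkm)) hM)
    obtain ⟨s, hs⟩ := ((extClosed_ext_left (LinearMap.ker f)).inAdd hK hT').exists_lift
      (LinearMap.ker f).injective_subtype (LinearMap.exact_subtype_ker_map f) hf T'.subtype
    have hs' : ∀ t, f (s t) = t := fun t => congr($hs t)
    have hsT : ∀ t, s t ∈ T := fun t => by
      have := hA.hom_subsingleton_of_inAdd (not_le_of_mem_diff hl) hT' hMT
      exact (Submodule.Quotient.mk_eq_zero T).1
        congr($(Subsingleton.elim (α := T' →ₗ[A] M ⧸ T) (T.mkQ ∘ₗ s) 0) t)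
    let K := LinearMap.ker f
    refine Filt.of_submodule (T.comap K.subtype) (.of_inAdd (l := l) hlS ?_)
      (.mono (S := S \ {l}) Set.sdiff_subset ?_)
    · let r : T →ₗ[A] M := T.subtype - s ∘ₗ f.restrict hle
      have hr : ∀ t : T, r t = t - s ⟨f t, hle t.2⟩ := fun _ => rfl
      have hrK : ∀ t : T, r t ∈ K := fun t => by
        rw [LinearMap.mem_ker, hr, map_sub, hs', sub_self]
      refine hT.of_retract (i := K.subtype.restrict (p := T.comap K.subtype) (q := T)
        fun x hx => hx) (p := (r.codRestrict K hrK).codRestrict (T.comap K.subtype)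
          fun t => T.sub_mem t.2 (hsT _)) ?_
      ext ⟨⟨x, hx⟩, hx'⟩
      have : (⟨f x, hle hx'⟩ : T') = 0 := Subtype.ext hx
      change r ⟨x, hx'⟩ = x
      rw [hr]
      simp only [this, map_zero, sub_zero]
    · let fbar := T.mapQ T' f hle
      have hfbar : Function.Surjective fbar := fun y => by
        obtain ⟨y, rfl⟩ := T'.mkQ_surjective y
        obtain ⟨x, rfl⟩ := hf y
        exact ⟨T.mkQ x, rfl⟩
      let q : K →ₗ[A] LinearMap.ker fbar := (T.mkQ ∘ₗ K.subtype).codRestrict _ fun x => by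
        have hx : f x = 0 := x.2
        change T'.mkQ (f x) = 0
        rw [hx, map_zero]
      have hq : Function.Surjective q := by
        rintro ⟨y, hy⟩
        obtain ⟨x, rfl⟩ := T.mkQ_surjective y
        have hx : f x ∈ T' := (Submodule.Quotient.mk_eq_zero T').1 hy
        refine ⟨⟨x - s ⟨f x, hx⟩, ?_⟩, Subtype.ext ?_⟩
        · rw [LinearMap.mem_ker, map_sub, hs', sub_self]
        · change T.mkQ (x - _) = T.mkQ x
          rw [map_sub, sub_eq_self]
          exact (Submodule.Quotient.mk_eq_zero T).2 (hsT _)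
      have hker : LinearMap.ker q = T.comap K.subtype := by
        ext x
        exact Subtype.ext_iff.trans (Submodule.Quotient.mk_eq_zero T)
      have := ih (M := ModuleCat.of A (M ⧸ T)) (N := ModuleCat.of A (N ⧸ T')) fbar hfbar hMT hNT
      exact this.of_equiv (Y := ModuleCat.of A (K ⧸ T.comap K.subtype))
        ((Submodule.quotEquivOfEq _ _ hker.symm).trans (q.quotKerEquivOfSurjective hq)).symm

theorem filt_of_projective (hA : IsSplitQuasiHereditary R A Δ) (X : Type u) [AddCommGroup X]
    [Module A X] [Module.Finite A X] [Module.Projective A X] :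
    Filt Δ Set.univ (ModuleCat.of A X) := by
  obtain ⟨P, hP, hadd⟩ := hA.exists_projectives
  refine (hA.extClosed_filt _).inAdd_directSum (fun l => ?_)
    ((hadd (ModuleCat.of A X)).2 ⟨‹_›, ‹_›⟩)
  obtain ⟨-, -, π, hπ, hker⟩ := hP l
  exact Filt.ext (X := ModuleCat.of A (LinearMap.ker π)) (Z := ModuleCat.of A (Δ l))
    (LinearMap.ker π).subtype π (LinearMap.ker π).injective_subtype
    (LinearMap.exact_subtype_ker_map π) hπ (hker.filt.mono (Set.subset_univ _))
    (.of_inAdd (Set.mem_univ l) .self)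

end IsSplitQuasiHereditary

end Peeling

/-! ### Finiteness and projectivity over the base ring -/

section Base

variable {R : Type*} [Ring R] {X Y Z : Type*} [AddCommGroup X] [AddCommGroup Y] [AddCommGroup Z]
  [Module R X] [Module R Y] [Module R Z] {f : X →ₗ[R] Y} {g : Y →ₗ[R] Z}

theorem exists_retraction_of_exact [Module.Projective R Z] (hf : Function.Injective f)
    (hfg : Function.Exact f g) (hg : Function.Surjective g) :
    ∃ r : Y →ₗ[R] X, r ∘ₗ f = LinearMap.id := by
  obtain ⟨s, hs⟩ := Module.projective_lifting_property g LinearMap.id hg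
  obtain ⟨e, rfl, -⟩ := hfg.splitSurjectiveEquiv hf ⟨s, hs⟩
  exact ⟨LinearMap.fst R X Z ∘ₗ e.toLinearMap, by ext; simp⟩

theorem projective_of_exact [Module.Projective R X] [Module.Projective R Z]
    (hf : Function.Injective f) (hfg : Function.Exact f g) (hg : Function.Surjective g) :
    Module.Projective R Y := by
  obtain ⟨s, hs⟩ := Module.projective_lifting_property g LinearMap.id hg
  exact .of_equiv (hfg.splitSurjectiveEquiv hf ⟨s, hs⟩).1.symm

theorem finite_of_exact [Module.Finite R X] [Module.Finite R Z] (hfg : Function.Exact f g)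
    (hg : Function.Surjective g) : Module.Finite R Y := by
  have : Module.Finite R (LinearMap.ker g) := by
    rw [hfg.linearMap_ker_eq]
    infer_instance
  have := Module.Finite.equiv (g.quotKerEquivOfSurjective hg).symm
  exact .of_submodule_quotient (LinearMap.ker g)

theorem finite_of_retract [Module.Finite R Y] {i : X →ₗ[R] Y} {p : Y →ₗ[R] X}
    (hip : p ∘ₗ i = LinearMap.id) : Module.Finite R X :=
  .of_surjective p fun x => ⟨i x, congr($hip x)⟩

end Base

section Restrict

variable (R : Type u) {A : Type u} [CommRing R] [Ring A] [Algebra R A]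

theorem projective_restrictScalars_iff (M : Type*) [AddCommGroup M] [Module R M] [Module A M]
    [IsScalarTower R A M] :
    Module.Projective R (RestrictScalars R A M) ↔ Module.Projective R M := by
  let e : RestrictScalars R A M ≃ₗ[R] M :=
    { RestrictScalars.addEquiv R A M with
      map_smul' := fun r x => by
        refine (RestrictScalars.addEquiv_map_smul R A M r x).trans ?_
        exact algebraMap_smul A r _ }
  exact ⟨fun _ => .of_equiv e, fun _ => .of_equiv e.symm⟩

theorem extClosed_finite : ExtClosed (A := A) fun X => Module.Finite A X where
  zero _ _ := inferInstance
  ext _ _ _ _ _ _ hfg hg _ _ := finite_of_exact hfg hg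
  retract _ _ _ _ hip _ := finite_of_retract hip

theorem extClosed_projective :
    ExtClosed (A := A) fun X => Module.Projective R (RestrictScalars R A X) where
  zero X hX := by
    let := Module.restrictScalars R A X
    have := IsScalarTower.restrictScalars R A X
    rw [projective_restrictScalars_iff]
    infer_instance
  ext X Y Z f g hf hfg hg hX hZ := by
    let := Module.restrictScalars R A X
    let := Module.restrictScalars R A Y
    let := Module.restrictScalars R A Z
    have := IsScalarTower.restrictScalars R A X
    have := IsScalarTower.restrictScalars R A Y
    have := IsScalarTower.restrictScalars R A Z
    rw [projective_restrictScalars_iff] at hX hZ ⊢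
    exact projective_of_exact (f := f.restrictScalars R) (g := g.restrictScalars R) hf hfg hg
  retract X Y i p hip hY := by
    let := Module.restrictScalars R A X
    let := Module.restrictScalars R A Y
    have := IsScalarTower.restrictScalars R A X
    have := IsScalarTower.restrictScalars R A Y
    rw [projective_restrictScalars_iff] at hY ⊢
    exact .of_split (i.restrictScalars R) (p.restrictScalars R)
      (LinearMap.ext fun x => congr($hip x))

variable {R} {Λ : Type w} [PartialOrder Λ]
  {Δ : Λ → Type u} [∀ l, AddCommGroup (Δ l)] [∀ l, Module R (Δ l)] [∀ l, Module A (Δ l)]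
  [∀ l, IsScalarTower R A (Δ l)]

namespace IsSplitQuasiHereditary

theorem isResolving [Finite Λ] (hA : IsSplitQuasiHereditary R A Δ) :
    IsResolving R A fun M : ModuleCat.{u} A => HasFiltration R A Δ Set.univ M := by
  simp only [hasFiltration_iff_filt R hA.algebraMap_bijective]
  exact
    { finite := fun M hM => extClosed_finite.filt (fun l _ => hA.finite l) hM
      projective := fun M hM => (extClosed_projective R).filt
        (fun l _ => (projective_restrictScalars_iff R (Δ l)).2 (hA.projective l)) hM
      of_projective := fun M _ _ => hA.filt_of_projective M
      extension := fun X Y Z f g hf hfg hg hX hZ => Filt.ext f g hf hfg hg hX hZ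
      summand := fun X M i p hip hM => hA.filt_retract _ i p hip hM
      kernel := fun M N f hf hM hN => hA.filt_ker _ f hf hM hN }

end IsSplitQuasiHereditary

end Restrict

/-! ### Homomorphisms out of a two-sided ideal -/

section IdealHom

variable {R A : Type u} [CommRing R] [Ring A] [Algebra R A]

/-- Restriction along `p : X → E` is an isomorphism `Hom(E, Y) ≃ Hom(X, Y)` if `p` is onto and
every map `X → Y` factors through `p`. -/
noncomputable def precompEquiv {X E Y : Type*} [AddCommGroup X] [AddCommGroup E] [AddCommGroup Y]
    [Module A X] [Module A E] [Module A Y] [Module R Y] [IsScalarTower R A Y] (p : X →ₗ[A] E)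
    (hp : Function.Surjective p) (h : ∀ φ : X →ₗ[A] Y, ∃ ψ : E →ₗ[A] Y, ψ ∘ₗ p = φ) :
    (E →ₗ[A] Y) ≃ₗ[R] (X →ₗ[A] Y) :=
  .ofBijective (LinearMap.lcomp R Y p) ⟨fun _ _ hab => (LinearMap.cancel_right hp).1 hab, h⟩

variable {D Y : Type u} [AddCommGroup D] [Module R D] [Module A D] [IsScalarTower R A D]
  [AddCommGroup Y] [Module R Y] [Module A Y] [IsScalarTower R A Y]

variable (R A) in
/-- Composition `Hom(E, D) ⊗ Hom(D, Y) → Hom(E, Y)`. -/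
noncomputable def compTensor (E D Y : Type u) [AddCommGroup E] [Module A E] [AddCommGroup D]
    [Module R D] [Module A D] [IsScalarTower R A D] [AddCommGroup Y] [Module R Y] [Module A Y]
    [IsScalarTower R A Y] : (E →ₗ[A] D) ⊗[R] (D →ₗ[A] Y) →ₗ[R] (E →ₗ[A] Y) :=
  TensorProduct.lift (LinearMap.mk₂ R (fun g v => v ∘ₗ g)
    (fun _ _ _ => LinearMap.comp_add _ _ _)
    (fun r g v => LinearMap.ext fun x => (v.restrictScalars R).map_smul r (g x))
    (fun _ _ _ => LinearMap.add_comp _ _ _) (fun _ _ _ => LinearMap.smul_comp _ _ _))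

theorem compTensor_tmul {E : Type u} [AddCommGroup E] [Module A E] (g : E →ₗ[A] D)
    (v : D →ₗ[A] Y) : compTensor R A E D Y (g ⊗ₜ v) = v ∘ₗ g := rfl

theorem compTensor_bijective (hD : Function.Bijective (algebraMap R (Module.End A D)))
    {E : Type u} [AddCommGroup E] [Module A E] (hE : InAdd A D E) :
    Function.Bijective (compTensor R A E D Y) := by
  obtain ⟨n, i', p', hsum⟩ := hE.exists_coordinates
  have hscalar : ∀ φ : D →ₗ[A] D, ∃ c : R, ∀ x, φ x = c • x := fun φ => by
    obtain ⟨c, rfl⟩ := hD.2 φ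
    exact ⟨c, fun x => rfl⟩
  -- Composing with the coordinate maps of `E` as a summand of `D ^ n` gives the inverse.
  let B : (E →ₗ[A] Y) → (E →ₗ[A] D) ⊗[R] (D →ₗ[A] Y) := fun h => ∑ k, i' k ⊗ₜ[R] (h ∘ₗ p' k)
  refine ⟨Function.LeftInverse.injective (g := B) fun t => ?_, fun h => ⟨B h, ?_⟩⟩
  · induction t with
    | zero => simp [B]
    | add x y hx hy =>
      conv_rhs => rw [← hx, ← hy]
      simp only [B, map_add, LinearMap.add_comp, TensorProduct.tmul_add, Finset.sum_add_distrib]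
    | tmul g v =>
      choose c hc using fun k => hscalar (g ∘ₗ p' k)
      have hg : g = ∑ k, c k • i' k := by
        ext e
        conv_lhs => rw [← hsum e, map_sum]
        rw [LinearMap.sum_apply]
        exact Finset.sum_congr rfl fun k _ => hc k _
      conv_rhs => rw [hg, TensorProduct.sum_tmul]
      refine Finset.sum_congr rfl fun k _ => ?_
      have : (v ∘ₗ g) ∘ₗ p' k = c k • v := by
        ext x
        exact (congrArg v (hc k x)).trans ((v.restrictScalars R).map_smul _ _)
      rw [compTensor_tmul, this, TensorProduct.tmul_smul, TensorProduct.smul_tmul']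
  · ext e
    simp only [B, map_sum, compTensor_tmul, LinearMap.sum_apply]
    conv_rhs => rw [← hsum e, map_sum]
    rfl

/-- Homomorphisms of left modules from an ideal `I` to `X`. It is a type of its own so that, for
a two-sided ideal, it can carry the left action of `A` that comes from right multiplication
on `I`. -/
def IdealHom (I : Ideal A) (X : Type u) [AddCommGroup X] [Module A X] : Type u := I →ₗ[A] X

section

variable (I : Ideal A) (X : Type u) [AddCommGroup X] [Module A X] [Module R X]
  [IsScalarTower R A X]

instance : AddCommGroup (IdealHom I X) := inferInstanceAs (AddCommGroup (I →ₗ[A] X))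

instance : Module R (IdealHom I X) := inferInstanceAs (Module R (I →ₗ[A] X))

variable [I.IsTwoSided]

/-- Right multiplication by `a` on a two-sided ideal. -/
def idealMulRight (a : A) : I →ₗ[A] I where
  toFun b := ⟨b * a, I.mul_mem_right a b.2⟩
  map_add' _ _ := Subtype.ext (add_mul _ _ _)
  map_smul' _ _ := Subtype.ext (mul_assoc _ _ _)

/-- The left action `(a • h) b = h (b * a)`. -/
instance : Module A (IdealHom I X) where
  smul a h := LinearMap.comp (show I →ₗ[A] X from h) (idealMulRight I a)
  one_smul h := LinearMap.ext fun _ =>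
    congrArg (show I →ₗ[A] X from h) (Subtype.ext (mul_one _))
  mul_smul _ _ h := LinearMap.ext fun _ =>
    congrArg (show I →ₗ[A] X from h) (Subtype.ext (mul_assoc _ _ _).symm)
  smul_zero _ := rfl
  smul_add _ _ _ := rfl
  add_smul a c h := LinearMap.ext fun b =>
    (congrArg (show I →ₗ[A] X from h)
      (show idealMulRight I (a + c) b = idealMulRight I a b + idealMulRight I c b from
        Subtype.ext (mul_add _ _ _))).trans (map_add _ _ _)
  zero_smul h := LinearMap.ext fun b =>
    (congrArg (show I →ₗ[A] X from h)
      (show idealMulRight I 0 b = 0 from Subtype.ext (mul_zero _))).trans (map_zero _)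

instance : IsScalarTower R A (IdealHom I X) where
  smul_assoc r a h := LinearMap.ext fun b => by
    refine (congrArg (show I →ₗ[A] X from h)
      (show idealMulRight I (r • a) b = r • idealMulRight I a b from
        Subtype.ext (mul_smul_comm _ _ _))).trans ?_
    exact ((show I →ₗ[A] X from h).restrictScalars R).map_smul r _

variable {X} in
/-- An element `y` of `Y` gives the homomorphism `b ↦ b • y` on the ideal `I`. -/
def toIdealHom : X →ₗ[A] IdealHom I X where
  toFun y := LinearMap.comp (LinearMap.toSpanSingleton A X y) I.subtype
  map_add' y z := LinearMap.ext fun b => smul_add (b : A) y z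
  map_smul' a y := LinearMap.ext fun b => smul_smul (b : A) a y

end

variable {I : Ideal A} [I.IsTwoSided]

theorem mem_ker_toIdealHom {y : Y} :
    y ∈ LinearMap.ker (toIdealHom I (X := Y)) ↔ ∀ b ∈ I, b • y = 0 :=
  ⟨fun h b hb => congrArg (fun g : I →ₗ[A] Y => g ⟨b, hb⟩) h,
    fun h => LinearMap.ext fun b => h b b.2⟩

theorem toIdealHom_surjective (h : ExtVanishes A (A ⧸ I) Y 1) :
    Function.Surjective (toIdealHom I (X := Y)) := fun φ => by
  obtain ⟨ψ, hψ⟩ := h.exists_extend I.injective_subtype (LinearMap.exact_subtype_mkQ I)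
    I.mkQ_surjective φ
  refine ⟨ψ 1, LinearMap.ext fun b => ?_⟩
  refine Eq.trans ?_ (LinearMap.congr_fun hψ b)
  change (b : A) • ψ 1 = ψ b
  rw [← map_smul, smul_eq_mul, mul_one]

/-- If `I` has a quotient `E` in the additive closure of `D` through which all the maps from `I`
to `D` and to `Y` factor, then `Hom(I, D) ⊗ Hom(D, Y) ≃ Hom(I, Y)`. -/
theorem exists_tensor_equiv_idealHom
    (hD : Function.Bijective (algebraMap R (Module.End A D))) {E : Type u} [AddCommGroup E]
    [Module A E] (hE : InAdd A D E) (p : I →ₗ[A] E) (hp : Function.Surjective p)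
    (h1 : ∀ φ : I →ₗ[A] D, ∃ ψ : E →ₗ[A] D, ψ ∘ₗ p = φ)
    (h2 : ∀ φ : I →ₗ[A] Y, ∃ ψ : E →ₗ[A] Y, ψ ∘ₗ p = φ) :
    Nonempty ((IdealHom I D ⊗[R] (D →ₗ[A] Y)) ≃ₗ[A] IdealHom I Y) := by
  let F : IdealHom I D ⊗[R] (D →ₗ[A] Y) →ₗ[A] IdealHom I Y :=
    TensorProduct.AlgebraTensorModule.lift
      { toFun := fun g =>
          { toFun := fun v => v ∘ₗ (show I →ₗ[A] D from g)
            map_add' := fun v v' => LinearMap.add_comp _ _ _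
            map_smul' := fun r v => LinearMap.smul_comp _ _ _ }
        map_add' := fun g g' => LinearMap.ext fun v => LinearMap.comp_add _ _ _
        map_smul' := fun a g => rfl }
  let e1 : ((E →ₗ[A] D) ⊗[R] (D →ₗ[A] Y)) ≃ₗ[R] (IdealHom I D ⊗[R] (D →ₗ[A] Y)) :=
    TensorProduct.congr (precompEquiv p hp h1) (.refl R _)
  let e2 : (E →ₗ[A] Y) ≃ₗ[R] (I →ₗ[A] Y) := precompEquiv p hp h2
  have hF : ∀ t, F (e1 t) = e2 (compTensor R A E D Y t) := fun t => by
    induction t with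
    | zero => simp only [map_zero]; rfl
    | add x y hx hy => simp only [map_add, hx, hy]; rfl
    | tmul g v => rfl
  have hF' : (F : IdealHom I D ⊗[R] (D →ₗ[A] Y) → IdealHom I Y) =
      e2 ∘ compTensor R A E D Y ∘ e1.symm := funext fun t => by
    rw [Function.comp_apply, Function.comp_apply, ← hF, e1.apply_symm_apply]
  refine ⟨.ofBijective F ?_⟩
  rw [hF']
  exact e2.bijective.comp ((compTensor_bijective hD hE).comp e1.symm.bijective)

/-- A projective module with no maps to `A ⧸ I` has no maps to modules annihilated by `I`: the
coordinates of its elements with respect to a dual basis lie in `I`. -/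
theorem hom_subsingleton_of_smul_eq_zero {I : Ideal A} {P : Type*} [AddCommGroup P] [Module A P]
    [Module.Projective A P] (h : Subsingleton (P →ₗ[A] A ⧸ I)) {Y : Type*} [AddCommGroup Y]
    [Module A Y] (hY : ∀ b ∈ I, ∀ y : Y, b • y = 0) : Subsingleton (P →ₗ[A] Y) := by
  obtain ⟨s, hs⟩ := Module.projective_def'.1 ‹Module.Projective A P›
  refine subsingleton_of_forall_eq 0 fun f => LinearMap.ext fun x => ?_
  have hmem : ∀ i, s x i ∈ I := fun i => by
    have := congr($(Subsingleton.elim (I.mkQ ∘ₗ Finsupp.lapply i ∘ₗ s) 0) x)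
    exact (Submodule.Quotient.mk_eq_zero I).1 this
  rw [← LinearMap.id_apply (R := A) x, ← hs, LinearMap.comp_apply,
    Finsupp.linearCombination_apply, map_finsuppSum]
  exact Finset.sum_eq_zero fun i _ => by
    exact (f.map_smul _ _).trans (hY _ (hmem i) _)

end IdealHom

/-! ### Modules with `Ext¹(Δ, Y) = 0` are filtered by costandard modules -/

section Costandard

variable {R A : Type u} [CommRing R] [Ring A] [Algebra R A] {Λ : Type w} [PartialOrder Λ]
  {Δ : Λ → Type u} [∀ l, AddCommGroup (Δ l)] [∀ l, Module R (Δ l)] [∀ l, Module A (Δ l)]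
  [∀ l, IsScalarTower R A (Δ l)]

namespace IsSplitQuasiHereditary

theorem subsingleton_of_hom [Finite Λ] (hA : IsSplitQuasiHereditary R A Δ) {Y : Type u}
    [AddCommGroup Y] [Module A Y] (h : ∀ l, Subsingleton (Δ l →ₗ[A] Y)) : Subsingleton Y := by
  have := (extClosed_hom_left Y).filt (fun l _ => h l) (hA.filt_of_projective A)
  refine subsingleton_of_forall_eq 0 fun y => ?_
  have := congr($(Subsingleton.elim (α := A →ₗ[A] Y) (LinearMap.toSpanSingleton A Y y) 0) 1)
  simpa using this

/-- `Hom(Δ l, Y) = Hom(P l, Y)` is a direct summand of `Y ^ n`, if no larger standard module maps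
to `Y`. -/
theorem hom_finite_projective (hA : IsSplitQuasiHereditary R A Δ) {l : Λ} {Y : Type u}
    [AddCommGroup Y] [Module R Y] [Module A Y] [IsScalarTower R A Y] [Module.Finite R Y]
    [Module.Projective R Y] (hY : ∀ m, l < m → Subsingleton (Δ m →ₗ[A] Y)) :
    Module.Finite R (Δ l →ₗ[A] Y) ∧ Module.Projective R (Δ l →ₗ[A] Y) := by
  obtain ⟨P, π, hP, hP', hπ, hker⟩ := hA.exists_presentation l
  have h0 := (extClosed_hom_left Y).filt hY hker
  let e1 : (Δ l →ₗ[A] Y) ≃ₗ[R] (P →ₗ[A] Y) := precompEquiv π hπ fun φ =>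
    exists_comp_eq_of_exact' (LinearMap.exact_subtype_ker_map π) hπ φ
      (Subsingleton.elim (α := LinearMap.ker π →ₗ[A] Y) _ _)
  obtain ⟨n, q, hq⟩ := Module.Finite.exists_fin' A P
  obtain ⟨s, hs⟩ := Module.projective_lifting_property q LinearMap.id hq
  let e2 : (Fin n → Y) ≃ₗ[R] ((Fin n → A) →ₗ[A] Y) := (Pi.basisFun A (Fin n)).constr R
  let i : (Δ l →ₗ[A] Y) →ₗ[R] (Fin n → Y) :=
    e2.symm.toLinearMap ∘ₗ LinearMap.lcomp R Y q ∘ₗ e1.toLinearMap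
  let p : (Fin n → Y) →ₗ[R] (Δ l →ₗ[A] Y) :=
    e1.symm.toLinearMap ∘ₗ LinearMap.lcomp R Y s ∘ₗ e2.toLinearMap
  have hip : p ∘ₗ i = LinearMap.id := by
    refine LinearMap.ext fun v => ?_
    change e1.symm (LinearMap.lcomp R Y s (e2 (e2.symm (LinearMap.lcomp R Y q (e1 v))))) = v
    rw [e2.apply_symm_apply, LinearEquiv.symm_apply_eq]
    exact LinearMap.ext fun x => congrArg (e1 v) congr($hs x)
  have : Module.Projective R (Fin n → Y) :=
    .of_equiv (DirectSum.linearEquivFunOnFintype R (Fin n) fun _ => Y)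
  exact ⟨finite_of_retract hip, .of_split i p hip⟩

/-- For a lower set `S` with maximal element `l`, let `J` be an ideal such that `A ⧸ J` is
filtered by the `Δ m`, `m ∈ S`, and which has no maps to the modules receiving no maps from the
`Δ m`, `m ∉ S`. There is a larger ideal `I` with the same properties for `S \ {l}`; it is two-sided
because `Hom(I, A ⧸ I) = 0`, and `I ⧸ J` is in the additive closure of `Δ l`. -/
theorem exists_ideal (hA : IsSplitQuasiHereditary R A Δ) {S : Set Λ} (hS : IsLowerSet S) {l : Λ}
    (hl : ∀ m ∈ S, ¬ l < m) {J : Ideal A} (hJ : Filt Δ S (ModuleCat.of A (A ⧸ J)))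
    (hJ' : ∀ Y : ModuleCat.{u} A, (∀ m ∉ S, Subsingleton (Δ m →ₗ[A] Y)) →
      Subsingleton (J →ₗ[A] Y)) :
    ∃ I : Ideal A, I.IsTwoSided ∧ Filt Δ (S \ {l}) (ModuleCat.of A (A ⧸ I)) ∧
      (∀ Y : ModuleCat.{u} A, (∀ m ∉ S \ {l}, Subsingleton (Δ m →ₗ[A] Y)) →
        Subsingleton (I →ₗ[A] Y)) ∧
      ∃ (E : ModuleCat.{u} A) (p : I →ₗ[A] E), InAdd A (Δ l) E ∧ Function.Surjective p ∧
        ∀ Y : ModuleCat.{u} A, (∀ m ∉ S, Subsingleton (Δ m →ₗ[A] Y)) →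
          ∀ φ : I →ₗ[A] Y, ∃ ψ : E →ₗ[A] Y, ψ ∘ₗ p = φ := by
  obtain ⟨T, hT, hJT⟩ := hA.exists_peel hl hJ
  let I : Ideal A := T.comap J.mkQ
  have hJI : J ≤ I := fun x hx => by
    change J.mkQ x ∈ T
    rw [show J.mkQ x = 0 from (Submodule.Quotient.mk_eq_zero J).2 hx]
    exact T.zero_mem
  let j : J →ₗ[A] I := Submodule.inclusion hJI
  let p : I →ₗ[A] T := J.mkQ.restrict (p := I) (q := T) fun x hx => hx
  have hp : Function.Surjective p := fun ⟨t, ht⟩ => by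
    obtain ⟨x, rfl⟩ := J.mkQ_surjective t
    exact ⟨⟨x, ht⟩, rfl⟩
  have hjp : Function.Exact j p := fun x => by
    refine Subtype.ext_iff.trans ((Submodule.Quotient.mk_eq_zero J).trans ?_)
    exact ⟨fun h => ⟨⟨x, h⟩, rfl⟩, fun ⟨y, hy⟩ => hy ▸ y.2⟩
  have hlow := isLowerSet_diff_singleton hS hl
  have hI : Filt Δ (S \ {l}) (ModuleCat.of A (A ⧸ I)) := by
    let q : A →ₗ[A] (A ⧸ J) ⧸ T := T.mkQ ∘ₗ J.mkQ
    have hq : LinearMap.ker q = I := by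
      ext x
      exact Submodule.Quotient.mk_eq_zero T
    exact hJT.of_equiv (Y := ModuleCat.of A (A ⧸ I)) ((Submodule.quotEquivOfEq _ _ hq.symm).trans
      (q.quotKerEquivOfSurjective (T.mkQ_surjective.comp J.mkQ_surjective))).symm
  have hI' : ∀ Y : ModuleCat.{u} A, (∀ m ∉ S \ {l}, Subsingleton (Δ m →ₗ[A] Y)) →
      Subsingleton (I →ₗ[A] Y) := fun Y hY =>
    (extClosed_hom_left Y).ext (X := ModuleCat.of A J) (Y := ModuleCat.of A I)
      (Z := ModuleCat.of A T) j p (Submodule.inclusion_injective hJI) hjp hp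
      (hJ' Y fun m hm => hY m fun h => hm h.1)
      ((extClosed_hom_left Y).inAdd (hY l fun h => h.2 rfl) hT)
  refine ⟨I, ⟨fun {x} a hx => ?_⟩, hI, hI', ModuleCat.of A T, p, hT, hp, fun Y hY φ => ?_⟩
  · have := hI' (ModuleCat.of A (A ⧸ I)) fun m hm => hA.hom_subsingleton_of_filt
      (fun k hk hmk => hm (hlow hmk hk)) hI
    have := congr($(Subsingleton.elim (α := I →ₗ[A] A ⧸ I)
      (I.mkQ ∘ₗ LinearMap.toSpanSingleton A A a ∘ₗ I.subtype) 0) ⟨x, hx⟩)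
    exact (Submodule.Quotient.mk_eq_zero I).1 this
  · have := hJ' Y hY
    exact exists_comp_eq_of_exact' hjp hp φ (Subsingleton.elim (α := J →ₗ[A] Y) _ _)

/-- With `I` as in `exists_ideal`, a submodule of `Y` annihilated by `I` receives no map from
`Δ l`. -/
theorem hom_subsingleton_of_ideal (hA : IsSplitQuasiHereditary R A Δ) {S : Set Λ} {l : Λ}
    (hl : ∀ m ∈ S, ¬ l < m) {I : Ideal A} (hI : Filt Δ (S \ {l}) (ModuleCat.of A (A ⧸ I)))
    {Y : Type u} [AddCommGroup Y] [Module A Y] (hY : ∀ b ∈ I, ∀ y : Y, b • y = 0) :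
    Subsingleton (Δ l →ₗ[A] Y) := by
  obtain ⟨P, π, hP, hP', hπ, hker⟩ := hA.exists_presentation l
  have hnot := not_le_of_mem_diff hl
  have hPI : Subsingleton (P →ₗ[A] A ⧸ I) :=
    (extClosed_hom_left (A ⧸ I)).ext (X := ModuleCat.of A (LinearMap.ker π)) (Y := P)
      (Z := ModuleCat.of A (Δ l)) (LinearMap.ker π).subtype π (LinearMap.ker π).injective_subtype
      (LinearMap.exact_subtype_ker_map π) hπ
      ((extClosed_hom_left (A ⧸ I)).filt (fun k hk => hA.hom_subsingleton_of_filt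
        (fun m hm hkm => hnot m hm ((le_of_lt hk).trans hkm)) hI) hker)
      (hA.hom_subsingleton_of_filt hnot hI)
  exact hom_subsingleton_of_surjective π hπ (hom_subsingleton_of_smul_eq_zero hPI hY)

end IsSplitQuasiHereditary

variable {nab : Λ → Type u} [∀ l, AddCommGroup (nab l)] [∀ l, Module R (nab l)]
  [∀ l, Module A (nab l)] [∀ l, IsScalarTower R A (nab l)]

theorem ker_smul_eq_zero {I : Ideal A} [I.IsTwoSided] {Y : Type u} [AddCommGroup Y]
    [Module A Y] : ∀ b ∈ I, ∀ y : LinearMap.ker (toIdealHom I (X := Y)), b • y = 0 :=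
  fun b hb y => Subtype.ext (mem_ker_toIdealHom.1 y.2 b hb)

/-- The costandard module is `Hom(I, Δ l)`, with `I` as in `exists_ideal`. -/
theorem IsCostandard.exists_equiv_idealHom [Finite Λ] (hA : IsSplitQuasiHereditary R A Δ)
    (hN : IsCostandard R A Δ nab) {S : Set Λ} (hS : IsLowerSet S) {l : Λ} (hlS : l ∈ S)
    (hl : ∀ m ∈ S, ¬ l < m) {I : Ideal A} [I.IsTwoSided]
    (hI : Filt Δ (S \ {l}) (ModuleCat.of A (A ⧸ I))) {E : ModuleCat.{u} A} (p : I →ₗ[A] E)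
    (hE : InAdd A (Δ l) E) (hp : Function.Surjective p)
    (hpY : ∀ Y : ModuleCat.{u} A, (∀ m ∉ S, Subsingleton (Δ m →ₗ[A] Y)) →
      ∀ φ : I →ₗ[A] Y, ∃ ψ : E →ₗ[A] Y, ψ ∘ₗ p = φ) :
    Nonempty (nab l ≃ₗ[A] IdealHom I (Δ l)) := by
  have hsurj : Function.Surjective (toIdealHom I (X := nab l)) := toIdealHom_surjective
    ((extClosed_ext_left (nab l)).filt (fun m _ => hN.ext_pos m l 1 one_pos) hI)
  have hker : Subsingleton (LinearMap.ker (toIdealHom I (X := nab l))) :=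
    hA.subsingleton_of_hom fun m => by
      by_cases hm : m = l
      · subst hm
        exact hA.hom_subsingleton_of_ideal hl hI ker_smul_eq_zero
      · exact hom_subsingleton_of_injective _ (Submodule.injective_subtype _) (hN.hom_ne m l hm)
  have hinj : Function.Injective (toIdealHom I (X := nab l)) :=
    LinearMap.ker_eq_bot.1 (Submodule.eq_bot_of_subsingleton)
  obtain ⟨e⟩ := exists_tensor_equiv_idealHom (Y := nab l) (hA.algebraMap_bijective l) hE p hp
    (hpY (ModuleCat.of A (Δ l)) fun m hm => hA.hom_subsingleton fun h => hm (hS h hlS))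
    (hpY (ModuleCat.of A (nab l)) fun m hm => hN.hom_ne m l fun h => hm (h ▸ hlS))
  obtain ⟨c⟩ := hN.hom_self l
  exact ⟨((LinearEquiv.ofBijective _ ⟨hinj, hsurj⟩).trans e.symm).trans
    ((TensorProduct.AlgebraTensorModule.congr (.refl A _) c).trans
      (TensorProduct.AlgebraTensorModule.rid R A _))⟩

/-- The induction runs over lower sets `S`, for modules `Y` receiving no maps from the `Δ m` with
`m ∉ S`. For `l` maximal in `S` and `I` as in `exists_ideal`, the map
`Y → Hom(I, Y) ≅ nab l ⊗ Hom(Δ l, Y)` is onto because `Ext¹(A ⧸ I, Y) = 0`, and its kernel is of the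
same kind for `S \ {l}`. -/
theorem IsCostandard.hasFiltration [Finite Λ] (hA : IsSplitQuasiHereditary R A Δ)
    (hN : IsCostandard R A Δ nab) (Y : Type u) [AddCommGroup Y] [Module R Y] [Module A Y]
    [IsScalarTower R A Y] [Module.Finite A Y] [Module.Projective R Y]
    (hY : ∀ l, ExtVanishes A (Δ l) Y 1) : HasFiltration R A nab Set.univ Y := by
  have := hA.alg_finite
  have := Module.Finite.trans (R := R) A Y
  suffices H : ∀ S : Set Λ, IsLowerSet S → ∀ J : Ideal A, Filt Δ S (ModuleCat.of A (A ⧸ J)) →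
      (∀ Y : ModuleCat.{u} A, (∀ m ∉ S, Subsingleton (Δ m →ₗ[A] Y)) →
        Subsingleton (J →ₗ[A] Y)) →
      ∀ (Y : Type u) [AddCommGroup Y] [Module R Y] [Module A Y] [IsScalarTower R A Y]
        [Module.Finite R Y] [Module.Projective R Y], (∀ m ∉ S, Subsingleton (Δ m →ₗ[A] Y)) →
        (∀ l, ExtVanishes A (Δ l) Y 1) → HasFiltration R A nab Set.univ Y by
    refine H Set.univ isLowerSet_univ ⊥ ?_ (fun Y _ => ?_) Y (fun m hm => (hm trivial).elim) hY
    · exact (hA.filt_of_projective A).of_equiv (Y := ModuleCat.of A (A ⧸ (⊥ : Ideal A)))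
        (Submodule.quotEquivOfEqBot (⊥ : Ideal A) rfl).symm
    · exact ⟨fun a b => LinearMap.ext fun x => by
        rw [Subsingleton.elim x 0, map_zero, map_zero]⟩
  clear! Y
  intro S
  induction S using maximal_induction with
  | h0 =>
    intro _ J _ _ Y _ _ _ _ _ _ hY _
    have := hA.subsingleton_of_hom fun m => hY m (Set.notMem_empty m)
    exact .of_subsingleton R Y
  | h S l hlS hl ih =>
    intro hS J hJ hJ' Y _ _ _ _ _ _ hY hext
    obtain ⟨I, _, hI, hI', E, p, hE, hp, hpY⟩ := hA.exists_ideal hS hl hJ hJ'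
    have hgt : ∀ m, l < m → Subsingleton (Δ m →ₗ[A] Y) := fun m hm =>
      hY m fun hmS => hl m hmS hm
    obtain ⟨hV, hV'⟩ := hA.hom_finite_projective hgt
    obtain ⟨e1⟩ := hN.exists_equiv_idealHom hA hS hlS hl hI p hE hp hpY
    obtain ⟨e2⟩ := exists_tensor_equiv_idealHom (Y := Y) (hA.algebraMap_bijective l) hE p hp
      (hpY (ModuleCat.of A (Δ l)) fun m hm => hA.hom_subsingleton fun h => hm (hS h hlS))
      (hpY (ModuleCat.of A Y) hY)
    let e : IdealHom I Y ≃ₗ[A] nab l ⊗[R] (Δ l →ₗ[A] Y) :=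
      e2.symm.trans (TensorProduct.AlgebraTensorModule.congr e1.symm (.refl R _))
    let ρ : Y →ₗ[A] IdealHom I Y := toIdealHom I
    have hρ : Function.Surjective ρ := toIdealHom_surjective
      ((extClosed_ext_left Y).filt (fun m _ => hext m) hI)
    -- The quotient of `Y` by the kernel of `ρ` is projective over `R`.
    have := hN.projective l
    have : Module.Projective R (IdealHom I Y) := .of_equiv (e.symm.restrictScalars R)
    have hexact := LinearMap.exact_subtype_ker_map ρ
    have hinj := (LinearMap.ker ρ).injective_subtype
    obtain ⟨r, hr⟩ := exists_retraction_of_exact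
      (f := (LinearMap.ker ρ).subtype.restrictScalars R) (g := ρ.restrictScalars R) hinj hexact hρ
    have : Module.Finite R (LinearMap.ker ρ) := finite_of_retract hr
    have : Module.Projective R (LinearMap.ker ρ) := .of_split _ r hr
    have hker : Subsingleton (Δ l →ₗ[A] LinearMap.ker ρ) :=
      hA.hom_subsingleton_of_ideal hl hI ker_smul_eq_zero
    have hlow := isLowerSet_diff_singleton hS hl
    refine (ih hlow I hI hI' (LinearMap.ker ρ) (fun m hm => ?_) fun m => ?_).step R hinj hexact hρ
      (Set.mem_univ l) (Δ l →ₗ[A] Y) e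
    · by_cases hml : m = l
      · exact hml ▸ hker
      · exact hom_subsingleton_of_injective _ hinj (hY m fun h => hm ⟨h, hml⟩)
    · by_cases hml : m = l
      · subst hml
        exact hA.extVanishes fun k hk => hom_subsingleton_of_injective _ hinj (hgt k hk)
      · -- There are no maps from `Δ m` to `nab l ⊗ Hom(Δ l, Y)`.
        have : Subsingleton (Δ m →ₗ[A] IdealHom I Y) :=
          hom_subsingleton_of_injective e.toLinearMap e.injective
            ((extClosed_hom_right (Δ m)).inAdd (Z := nab l ⊗[R] (Δ l →ₗ[A] Y)) (hN.hom_ne m l hml)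
              (inAdd_tensorProduct R (Δ l →ₗ[A] Y)))
        exact .of_exists_lift hinj hexact hρ (hext m) fun φ => ⟨0, Subsingleton.elim _ _⟩

end Costandard

/-! ### Approximation of modules by modules with standard filtrations -/

section Pushout

variable {A : Type u} [Ring A] {C K P Q Z : Type*} [AddCommGroup C] [AddCommGroup K]
  [AddCommGroup P] [AddCommGroup Q] [AddCommGroup Z] [Module A C] [Module A K] [Module A P]
  [Module A Q] [Module A Z]

/-- `Q`, with the maps `j` and `h`, is the pushout of `a` and `b`. -/
structure IsModulePushout (a : C →ₗ[A] K) (b : C →ₗ[A] P) (j : K →ₗ[A] Q) (h : P →ₗ[A] Q) :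
    Prop where
  comm : ∀ c, j (a c) = h (b c)
  exists_eq_add : ∀ x, ∃ k p, x = j k + h p
  exists_of_add_eq_zero : ∀ k p, j k + h p = 0 → ∃ c, k = a c ∧ p = -b c

theorem exists_isModulePushout {C K P : Type u} [AddCommGroup C] [AddCommGroup K]
    [AddCommGroup P] [Module A C] [Module A K] [Module A P] (a : C →ₗ[A] K) (b : C →ₗ[A] P) :
    ∃ (Q : ModuleCat.{u} A) (j : K →ₗ[A] Q) (h : P →ₗ[A] Q), IsModulePushout a b j h := by
  let N := LinearMap.range (a.prod (-b))
  have hN : ∀ k p, N.mkQ (k, 0) + N.mkQ (0, p) = N.mkQ (k, p) := fun k p => by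
    rw [← map_add, Prod.mk_add_mk, add_zero, zero_add]
  refine ⟨ModuleCat.of A ((K × P) ⧸ N), N.mkQ ∘ₗ LinearMap.inl A K P, N.mkQ ∘ₗ LinearMap.inr A K P,
    fun c => ?_, fun x => ?_, fun k p hkp => ?_⟩
  · exact (Submodule.Quotient.eq N).2 ⟨c, by simp⟩
  · obtain ⟨⟨k, p⟩, rfl⟩ := N.mkQ_surjective x
    exact ⟨k, p, (hN k p).symm⟩
  · obtain ⟨c, hc⟩ := (Submodule.Quotient.mk_eq_zero N).1 ((hN k p).symm.trans hkp)
    exact ⟨c, congr($hc.1).symm, congr($hc.2).symm⟩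

namespace IsModulePushout

variable {a : C →ₗ[A] K} {b : C →ₗ[A] P} {j : K →ₗ[A] Q} {h : P →ₗ[A] Q}
  (hQ : IsModulePushout a b j h)
include hQ

theorem symm : IsModulePushout b a h j where
  comm c := (hQ.comm c).symm
  exists_eq_add x := by
    obtain ⟨k, p, hx⟩ := hQ.exists_eq_add x
    exact ⟨p, k, hx.trans (add_comm _ _)⟩
  exists_of_add_eq_zero p k hpk := by
    obtain ⟨c, hk, hp⟩ := hQ.exists_of_add_eq_zero k p ((add_comm _ _).trans hpk)
    exact ⟨-c, by rw [hp, map_neg], by rw [hk, map_neg, neg_neg]⟩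

theorem injective (hb : Function.Injective b) : Function.Injective j := by
  refine (injective_iff_map_eq_zero j).2 fun k hk => ?_
  obtain ⟨c, rfl, hc⟩ := hQ.exists_of_add_eq_zero k 0 (by rw [hk, map_zero, add_zero])
  rw [(injective_iff_map_eq_zero b).1 hb c (neg_eq_zero.1 hc.symm), map_zero]

/-- The cokernel of `j` is the cokernel of `b`. -/
theorem exists_exact {g : P →ₗ[A] Z} (hbg : Function.Exact b g) (hg : Function.Surjective g) :
    ∃ q : Q →ₗ[A] Z, Function.Exact j q ∧ Function.Surjective q := by
  have hex : Function.Exact (a.prod (-b)) (j.coprod h) := by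
    rintro ⟨k, p⟩
    constructor
    · intro hkp
      obtain ⟨c, rfl, rfl⟩ := hQ.exists_of_add_eq_zero k p hkp
      exact ⟨c, rfl⟩
    · rintro ⟨c, hc⟩
      rw [← hc]
      simp [hQ.comm]
  have hsurj : Function.Surjective (j.coprod h) := fun x => by
    obtain ⟨k, p, rfl⟩ := hQ.exists_eq_add x
    exact ⟨(k, p), rfl⟩
  obtain ⟨q, hq⟩ := exists_comp_eq_of_exact' hex hsurj (g ∘ₗ LinearMap.snd A K P) (by
    ext c
    simp [hbg.apply_apply_eq_zero c])
  have hq' : ∀ k p, q (j k + h p) = g p := fun k p => congr($hq (k, p))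
  refine ⟨q, fun x => ⟨fun hx => ?_, ?_⟩, fun z => ?_⟩
  · obtain ⟨k, p, rfl⟩ := hQ.exists_eq_add x
    obtain ⟨c, rfl⟩ := (hbg p).1 ((hq' k p).symm.trans hx)
    exact ⟨k + a c, by rw [map_add, hQ.comm]⟩
  · rintro ⟨k, rfl⟩
    have := hq' k 0
    rwa [map_zero, map_zero, add_zero] at this
  · obtain ⟨p, rfl⟩ := hg z
    exact ⟨j 0 + h p, hq' 0 p⟩

end IsModulePushout

end Pushout

section Approximation

variable {R A : Type u} [CommRing R] [Ring A] [Algebra R A]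

theorem finite_hom [IsNoetherianRing R] {C K : Type u} [AddCommGroup C] [Module A C]
    [AddCommGroup K] [Module R K] [Module A K] [IsScalarTower R A K] [Module.Finite A C]
    [Module.Finite R K] : Module.Finite R (C →ₗ[A] K) := by
  obtain ⟨m, q, hq⟩ := Module.Finite.exists_fin' A C
  let e : (Fin m → K) ≃ₗ[R] ((Fin m → A) →ₗ[A] K) := (Pi.basisFun A (Fin m)).constr R
  exact Module.Finite.of_injective (e.symm.toLinearMap ∘ₗ LinearMap.lcomp R K q)
    (e.symm.injective.comp fun _ _ h => (LinearMap.cancel_right hq).1 h)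

variable {Λ : Type w} [PartialOrder Λ] {Δ : Λ → Type u} [∀ l, AddCommGroup (Δ l)]
  [∀ l, Module R (Δ l)] [∀ l, Module A (Δ l)] [∀ l, IsScalarTower R A (Δ l)]

namespace IsSplitQuasiHereditary

/-- A universal extension of copies of `Δ l` by `K`: the pushout of `C ^ n → P ^ n` along a
generating family of `Hom(C, K)`, where `0 → C → P → Δ l → 0` is the given presentation. -/
theorem exists_universal_extension [IsNoetherianRing R] (hA : IsSplitQuasiHereditary R A Δ)
    (l : Λ) (K : ModuleCat.{u} A) [Module.Finite A K] :
    ∃ (Q : ModuleCat.{u} A) (j : K →ₗ[A] Q) (n : ℕ) (q : Q →ₗ[A] (Fin n → Δ l)),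
      Function.Injective j ∧ Function.Exact j q ∧ Function.Surjective q ∧
        ExtVanishes A (Δ l) Q 1 := by
  obtain ⟨P, π, hP, hP', hπ, hker⟩ := hA.exists_presentation l
  let C := LinearMap.ker π
  let := Module.restrictScalars R A K
  have := IsScalarTower.restrictScalars R A K
  have := hA.alg_finite
  have := Module.Finite.trans (R := R) A K
  have : Module.Finite A C := extClosed_finite.filt (fun m _ => hA.finite m) hker
  have : Module.Finite R (C →ₗ[A] K) := finite_hom
  obtain ⟨n, f, hf⟩ := Module.Finite.exists_fin (R := R) (M := C →ₗ[A] K)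
  let a : (Fin n → C) →ₗ[A] K := ∑ i, f i ∘ₗ LinearMap.proj i
  let b : (Fin n → C) →ₗ[A] (Fin n → P) := LinearMap.pi fun i => C.subtype ∘ₗ LinearMap.proj i
  let g : (Fin n → P) →ₗ[A] (Fin n → Δ l) := LinearMap.pi fun i => π ∘ₗ LinearMap.proj i
  have hb : Function.Injective b := fun x y h => funext fun i => Subtype.ext congr($h i)
  have hbg : Function.Exact b g := fun x =>
    ⟨fun h => ⟨fun i => ⟨x i, congr($h i)⟩, rfl⟩, by
      rintro ⟨y, rfl⟩
      exact funext fun i => (y i).2⟩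
  have hg : Function.Surjective g := fun z => by
    choose y hy using fun i => hπ (z i)
    exact ⟨y, funext hy⟩
  obtain ⟨Q, j, h, hQ⟩ := exists_isModulePushout a b
  obtain ⟨q, hjq, hq⟩ := hQ.exists_exact hbg hg
  refine ⟨Q, j, n, q, hQ.injective hb, hjq, hq, ?_⟩
  refine .of_exists_extend C.injective_subtype (LinearMap.exact_subtype_ker_map π) hπ fun φ => ?_
  -- A map `φ : C → Q` factors through `K`, since larger standard modules do not map to `Δ l`.
  have h0 : Subsingleton (C →ₗ[A] (Fin n → Δ l)) := (extClosed_hom_left (Fin n → Δ l)).filt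
    (fun m hm => (extClosed_hom_right (Δ m)).pi_fin fun _ =>
      hA.hom_subsingleton (not_le_of_gt hm)) hker
  obtain ⟨φ', rfl⟩ := exists_comp_eq_of_exact (hQ.injective hb) hjq φ (Subsingleton.elim _ _)
  obtain ⟨r, rfl⟩ := (Submodule.mem_span_range_iff_exists_fun R).1
    (hf.symm ▸ Submodule.mem_top : φ' ∈ Submodule.span R (Set.range f))
  let := Module.restrictScalars R A Q
  have := IsScalarTower.restrictScalars R A Q
  refine ⟨∑ i, r i • (h ∘ₗ LinearMap.single A (fun _ => (P : Type u)) i), LinearMap.ext fun c => ?_⟩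
  have key : ∀ i, h (Pi.single i (c : P)) = j (f i c) := fun i => by
    have h1 : b (Pi.single i c) = Pi.single i (c : P) := by
      ext k
      rcases eq_or_ne k i with rfl | hk
      · simp [b]
      · simp [b, hk]
    have h2 : a (Pi.single i c) = f i c := by
      simp only [a, LinearMap.sum_apply, LinearMap.comp_apply, LinearMap.proj_apply]
      rw [Finset.sum_eq_single i (fun k _ hk => by rw [Pi.single_eq_of_ne hk, map_zero])
        (fun hi => absurd (Finset.mem_univ i) hi), Pi.single_eq_same]
    rw [← h1, ← h2, hQ.comm]
  simp only [LinearMap.comp_apply, LinearMap.sum_apply, LinearMap.smul_apply, map_sum]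
  refine Finset.sum_congr rfl fun i _ => ?_
  exact (congrArg (r i • ·) (key i)).trans ((j.restrictScalars R).map_smul (r i) (f i c)).symm

/-- Every finitely generated module `M` is a quotient of a module with a standard filtration, with
kernel `Y` such that `Ext¹(Δ l, Y) = 0` for all `l`. The kernel of a free cover of `M` is enlarged
by universal extensions, for larger weights before smaller ones, as `Ext¹(Δ m, Δ l) ≠ 0` forces
`m < l`. -/
theorem exists_approximation [IsNoetherianRing R] [Finite Λ] (hA : IsSplitQuasiHereditary R A Δ)
    (M : Type u) [AddCommGroup M] [Module A M] [Module.Finite A M] :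
    ∃ (Y X : ModuleCat.{u} A) (f : Y →ₗ[A] X) (g : X →ₗ[A] M), Function.Injective f ∧
      Function.Exact f g ∧ Function.Surjective g ∧ Module.Finite A Y ∧ Filt Δ Set.univ X ∧
      ∀ l, ExtVanishes A (Δ l) Y 1 := by
  have := hA.alg_finite
  have := isNoetherian_of_isNoetherianRing_of_finite R A
  have : IsNoetherianRing A := isNoetherian_of_tower R this
  suffices H : ∀ S : Set Λ, IsLowerSet S → ∀ (K X : ModuleCat.{u} A) (f : K →ₗ[A] X)
      (g : X →ₗ[A] M), Function.Injective f → Function.Exact f g → Function.Surjective g →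
      Filt Δ Set.univ X → (∀ l ∉ S, ExtVanishes A (Δ l) K 1) →
      ∃ (Y X : ModuleCat.{u} A) (f : Y →ₗ[A] X) (g : X →ₗ[A] M), Function.Injective f ∧
        Function.Exact f g ∧ Function.Surjective g ∧ Module.Finite A Y ∧ Filt Δ Set.univ X ∧
        ∀ l, ExtVanishes A (Δ l) Y 1 by
    obtain ⟨n, q, hq⟩ := Module.Finite.exists_fin' A M
    exact H Set.univ isLowerSet_univ (ModuleCat.of A (LinearMap.ker q))
      (ModuleCat.of A (Fin n → A)) (LinearMap.ker q).subtype q (LinearMap.ker q).injective_subtype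
      (LinearMap.exact_subtype_ker_map q) hq
      ((hA.extClosed_filt _).pi_fin fun _ => hA.filt_of_projective A)
      fun l hl => (hl trivial).elim
  intro S
  have hfin : ∀ {K X : ModuleCat.{u} A} (f : K →ₗ[A] X), Function.Injective f →
      Filt Δ Set.univ X → Module.Finite A K := fun f hf hX => by
    have := extClosed_finite.filt (fun m _ => hA.finite m) hX
    exact Module.Finite.of_injective f hf
  induction S using maximal_induction with
  | h0 =>
    intro _ K X f g hf hfg hg hX hK
    exact ⟨K, X, f, g, hf, hfg, hg, hfin f hf hX, hX, fun l => hK l (Set.notMem_empty l)⟩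
  | h S l hlS hl ih =>
    intro hS K X f g hf hfg hg hX hK
    have := hfin f hf hX
    obtain ⟨Q, j, n, q, hj, hjq, hq, hQ⟩ := hA.exists_universal_extension l K
    obtain ⟨X', i, h, hX'⟩ := exists_isModulePushout j f
    obtain ⟨g', hg', hg''⟩ := hX'.exists_exact hfg hg
    obtain ⟨q', hq', hq''⟩ := hX'.symm.exists_exact hjq hq
    have hlow := isLowerSet_diff_singleton hS hl
    refine ih hlow Q X' i g' (hX'.injective hf) hg' hg'' ?_ fun m hm => ?_
    · exact Filt.ext (Z := ModuleCat.of A (Fin n → Δ l)) h q' (hX'.symm.injective hj) hq' hq'' hX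
        (.of_inAdd (Set.mem_univ l) (.pi_self n))
    · by_cases hml : m = l
      · exact hml ▸ hQ
      · have hmS : m ∉ S := fun h => hm ⟨h, hml⟩
        refine .of_exact_right hj hjq hq (hK m hmS) ((extClosed_ext_right (Δ m)).pi_fin fun _ => ?_)
        exact hA.extVanishes fun k hk => hA.hom_subsingleton fun hkl =>
          hmS (hS (hk.le.trans hkl) hlS)

end IsSplitQuasiHereditary

variable {nab : Λ → Type u} [∀ l, AddCommGroup (nab l)] [∀ l, Module R (nab l)]
  [∀ l, Module A (nab l)] [∀ l, IsScalarTower R A (nab l)]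

theorem IsCostandard.hasFiltration_standard [IsNoetherianRing R] [Finite Λ]
    (hA : IsSplitQuasiHereditary R A Δ) (hN : IsCostandard R A Δ nab) (M : Type u)
    [AddCommGroup M] [Module R M] [Module A M] [IsScalarTower R A M] [Module.Finite A M]
    [Module.Projective R M] (hM : ∀ l, ExtVanishes A M (nab l) 1) :
    HasFiltration R A Δ Set.univ M := by
  obtain ⟨Y, X, f, g, hf, hfg, hg, _, hX, hY⟩ := hA.exists_approximation M
  let := Module.restrictScalars R A Y
  have := IsScalarTower.restrictScalars R A Y
  let := Module.restrictScalars R A X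
  have := IsScalarTower.restrictScalars R A X
  have hXR := (projective_restrictScalars_iff R X).1 ((extClosed_projective R).filt
    (fun l _ => (projective_restrictScalars_iff R (Δ l)).2 (hA.projective l)) hX)
  obtain ⟨r, hr⟩ := exists_retraction_of_exact (f := f.restrictScalars R)
    (g := g.restrictScalars R) hf hfg hg
  have : Module.Projective R Y := .of_split _ r hr
  have hMY : ExtVanishes A M Y 1 := (extClosed_ext_right M).filt (fun l _ => hM l)
    (hN.hasFiltration hA Y hY).filt
  -- The approximation sequence splits.
  obtain ⟨s, hs⟩ := hMY.exists_lift hf hfg hg LinearMap.id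
  exact (hasFiltration_iff_filt R hA.algebraMap_bijective (M := ModuleCat.of A M)).2
    (hA.filt_retract _ (X := ModuleCat.of A M) s g hs hX)

end Approximation

end SplitQH

theorem mainTheorem6 (R A : Type u) [CommRing R] [IsNoetherianRing R] [Ring A] [Algebra R A]
    (Λ : Type w) [PartialOrder Λ] [Finite Λ]
    (Δ : Λ → Type u) [∀ l, AddCommGroup (Δ l)] [∀ l, Module R (Δ l)] [∀ l, Module A (Δ l)]
    [∀ l, IsScalarTower R A (Δ l)]
    (hA : SplitQH.IsSplitQuasiHereditary R A Δ) :
    (∀ (nab : Λ → Type u) [∀ l, AddCommGroup (nab l)] [∀ l, Module R (nab l)]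
      [∀ l, Module A (nab l)] [∀ l, IsScalarTower R A (nab l)],
      SplitQH.IsCostandard R A Δ nab →
      ∀ (M : Type u) [AddCommGroup M] [Module R M] [Module A M] [IsScalarTower R A M],
        Module.Finite A M → Module.Projective R M →
        ((∀ l, SplitQH.ExtVanishes A M (nab l) 1) →
          SplitQH.HasFiltration R A Δ Set.univ M) ∧
        ((∀ l, SplitQH.ExtVanishes A (Δ l) M 1) →
          SplitQH.HasFiltration R A nab Set.univ M)) ∧
    SplitQH.IsResolving R A
      (fun M : ModuleCat.{u} A => SplitQH.HasFiltration R A Δ Set.univ M) := by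
  refine ⟨?_, hA.isResolving⟩
  intro nab _ _ _ _ hN M _ _ _ _ _ _
  exact ⟨hN.hasFiltration_standard hA M, hN.hasFiltration hA M⟩
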